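/- Let $\theta>1$ be fixed. An election has a set $\mathcal N$ of $n$ voters, a set $\mathcal A$ of $m$ candidates, and a distance function (pseudometric) $d$ on $\mathcal N\cup\mathcal A$. The social cost of a candidate $j$ is $SC(j,d)=\sum_{i\in\mathcal N}d(i,j)$. Under the Plackett–Luce model with parameter $\theta$, the voters independently submit random rankings of the candidates. Voter $i$ chooses the top candidate, and then successively each next candidate among the remaining ones, with probability proportional to the strengths $d(i,j)^{-\theta}$. Candidates at distance $0$ from the voter are ranked above all others, in uniformly random order among themselves. The Borda score of a candidate $j$ is $\sum_{j'\neq j}|jj'|$, where $|jj'|$ is the number of voters that rank $j$ above $j'$. A Borda rule elects a candidate with maximal Borda score, where ties are broken arbitrarily (possibly at random) as a function of the submitted rankings. Let $$\mathrm{dist}^{\theta}_{PL}(\mathrm{Borda},m,n)=\sup_{d}\ \frac{\mathbb E\,[SC(\text{winner},d)]}{\min_{j\in\mathcal A}SC(j,d)}$$ be the metric distortion of the Borda rule, where the supremum is over all such distance functions for $n$ voters and $m$ candidates, $0/0$ counts as $0$, and the expectation is over the votes and the tie-breaking. **Theorem.** For every $\theta>1$ and every $m\ge 1$, the limit $\lim_{n\to\infty}\mathrm{dist}^{\theta}_{PL}(\mathrm{Borda},m,n)$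 exists, is finite, and does not depend on how ties are broken. As $m\to\infty$ with $\theta$ fixed, $$\lim_{n\to\infty}\mathrm{dist}^{\theta}_{PL}(\mathrm{Borda},m,n)=\Theta\!\left(m^{\max(1-2/\theta,\,0)}\right).$$ -/

import Mathlib

open Filter Topology Asymptotics
open scoped ENNReal NNReal

namespace MetricVoting

noncomputable section

/-- A total order on `m` candidates: `r k` is the candidate in position `k`, position `0` being
the top one. -/
abbrev Ranking (m : ℕ) : Type := Equiv.Perm (Fin m)

/-- `r` ranks candidate `a` above candidate `b`. -/
def Ranking.Above {m : ℕ} (r : Ranking m) (a b : Fin m) : Prop := r.symm a < r.symm b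

instance {m : ℕ} (r : Ranking m) (a b : Fin m) : Decidable (r.Above a b) :=
  inferInstanceAs (Decidable (r.symm a < r.symm b))

/-- A vote profile: one ranking for each of the `n` voters. -/
abbrev Profile (n m : ℕ) : Type := Fin n → Ranking m

/-- A (possibly randomized) voting rule for `n` voters and `m` candidates. -/
abbrev VotingRule (n m : ℕ) : Type := Profile n m → PMF (Fin m)

/-- The number of voters that rank candidate `a` above candidate `b`. -/
def pairwiseVotes {n m : ℕ} (σ : Profile n m) (a b : Fin m) : ℕ :=
  (Finset.univ.filter fun i : Fin n => (σ i).Above a b).card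

/-- The Borda score: the total number of votes over all other candidates in pairwise contests. -/
def bordaScore {n m : ℕ} (σ : Profile n m) (a : Fin m) : ℕ :=
  ∑ b ∈ Finset.univ.erase a, pairwiseVotes σ a b

/-- `f` is a Borda rule: it only elects candidates of maximal Borda score. How it breaks ties
(deterministically or at random) is left open. -/
def IsBordaRule {n m : ℕ} (f : VotingRule n m) : Prop :=
  ∀ (σ : Profile n m) (a : Fin m), a ∈ (f σ).support → ∀ b : Fin m, bordaScore σ b ≤ bordaScore σ a

/-- The distance between voter `i` and candidate `j`, for a pseudometric `D` on voters and
candidates together. -/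
def cost {n m : ℕ} (D : PseudoMetricSpace (Fin n ⊕ Fin m)) (i : Fin n) (j : Fin m) : ℝ :=
  D.dist (Sum.inl i) (Sum.inr j)

/-- The social cost of candidate `j`. -/
def socialCost {n m : ℕ} (D : PseudoMetricSpace (Fin n ⊕ Fin m)) (j : Fin m) : ℝ :=
  ∑ i, cost D i j

/-- The probability that a Plackett–Luce voter with cost vector `c`, that is with strengths
`c k ^ (-θ)`, picks `j` when choosing among the candidates in `R` (with `j ∈ R`).
A candidate at distance `0` has infinite strength: if `R` contains such candidates, then one of
them is picked, uniformly at random. -/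
def choiceProb {m : ℕ} (θ : ℝ) (c : Fin m → ℝ) (R : Finset (Fin m)) (j : Fin m) : ℝ :=
  if ∃ k ∈ R, c k = 0 then
    if c j = 0 then 1 / ((R.filter fun k => c k = 0).card : ℝ) else 0
  else c j ^ (-θ) / ∑ k ∈ R, c k ^ (-θ)

/-- The Plackett–Luce probability of the ranking `r`: the candidate in each position is chosen
among the candidates that do not occupy an earlier position. -/
def plProb {m : ℕ} (θ : ℝ) (c : Fin m → ℝ) (r : Ranking m) : ℝ :=
  ∏ k : Fin m, choiceProb θ c (Finset.univ.filter fun j => k ≤ r.symm j) (r k)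

/-- The probability of the profile `σ` when the voters vote independently of each other, each
according to the Plackett–Luce model. -/
def profileProb {n m : ℕ} (θ : ℝ) (D : PseudoMetricSpace (Fin n ⊕ Fin m)) (σ : Profile n m) : ℝ :=
  ∏ i, plProb θ (cost D i) (σ i)

/-- The expected social cost of the winner, over the votes and the randomness of the rule. -/
def expectedCost {n m : ℕ} (θ : ℝ) (D : PseudoMetricSpace (Fin n ⊕ Fin m)) (f : VotingRule n m) :
    ℝ :=
  ∑ σ : Profile n m, profileProb θ D σ * ∑ j, (f σ j).toReal * socialCost D j

/-- The metric distortion of the voting rule `f` under the Plackett–Luce model with parameter `θ`: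
the supremum, over all distance functions on `n` voters and `m` candidates, of the expected social
cost of the winner over the minimum social cost. In `ℝ≥0∞` a positive number divided by `0` is `∞`,
and `0 / 0 = 0`. -/
def distortionPL {n m : ℕ} (θ : ℝ) (f : VotingRule n m) : ℝ≥0∞ :=
  ⨆ D : PseudoMetricSpace (Fin n ⊕ Fin m),
    ENNReal.ofReal (expectedCost θ D f) / ⨅ j, ENNReal.ofReal (socialCost D j)

end

end MetricVoting

/-!
# The metric distortion of Borda under the Plackett–Luce model

In the Plackett–Luce model a candidate at distance `x` from a voter is ranked above one at distance
`y` with probability `pairProb θ x y = y ^ θ / (x ^ θ + y ^ θ)` (`sum_plProb_above`). So the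
expected Borda scores are explicit sums of such terms, and by Chebyshev's inequality an election
with many voters is won by a candidate whose expected score is almost maximal.

**The limit.** It is the supremum `limitDistortion` of `socialCost D j / socialCost D k` over all
elections in which `j` wins strictly in expectation, up to candidates at the same location. Copying
the voters of such an election shows that the distortion is eventually at least any such ratio
(`exists_tendsto_le_distortionPL`). For the converse the estimates must be uniform in the distance
function. A candidate `j` with `socialCost D j ≥ (1 + 4 * m) * socialCost D k` contributes only
`O(1 / n)` times the optimal cost, since the expected number of voters ranking `j` above `k` is at
most `2 * socialCost D k / d(j, k)`, while `j` needs `n / m` such voters to win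
(`winProb_mul_socialCost_le`). Among the other candidates, those whose expected score is far from
maximal are elected with probability `O(1 / n)`, and those whose expected score is almost maximal
become strict winners when a few voters are added at their location, which hardly changes the ratio
of the costs (`socialCost_le_of_almost_winner`).

**Its upper bound.** Let `j` have maximal expected score, and let `d(j, k) = 1`. Compare `j` with
the average of the candidates within distance `1 / 4` of `k`. There are `q ≥ 1` of these, counting
`k` itself; let `t` be the distances of all other candidates from `k`. A voter close to `k` makes
`j` lose at least a constant times `q + ∑ t ^ (-θ)` (`exists_far_loss`). A voter at distance
`x ≥ 1 / 8` from `k` lets `j` gain at most a constant times `x * (q + ∑ t ^ (-α))`, where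
`α = min θ 2` (`exists_far_gain`). By the power mean inequality
`∑ t ^ (-α) ≤ m ^ (1 - α / θ) * (1 + ∑ t ^ (-θ))`, so the distances of the voters from `k` add up to
at least a constant times `n / m ^ (1 - α / θ)`, whereas `socialCost D j ≤ socialCost D k + n`.

**Its lower bound.** If `k` is at `0`, `j` at `1` and all others at `Z = m ^ (1 / θ)` on a line,
then voters at `0` cost `j` only a bounded number of points relative to `k`, and a proportion of
order `Z / m` of voters at `Z / 2` makes up for this. The average cost of `k` is then of order
`Z ^ 2 / m`, and that of `j` is of order `1` at least (`exists_winnerRatio_ge`).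
-/

namespace MetricVoting

/-! ### Pairwise comparisons in the Plackett–Luce model -/

/-- The probability that a Plackett–Luce voter ranks a candidate at distance `x` above another
candidate at distance `y`. The value `1 / 2` for two candidates at distance `0` comes from the
uniformly random order among such candidates. For one and the same candidate the formula gives
`1 / 2` as well. -/
noncomputable def pairProb (θ x y : ℝ) : ℝ :=
  if x = 0 ∧ y = 0 then 1 / 2 else y ^ θ / (x ^ θ + y ^ θ)

lemma choiceProb_nonneg {m : ℕ} {θ : ℝ} {c : Fin m → ℝ} (hc : ∀ j, 0 ≤ c j) (R : Finset (Fin m))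
    (j : Fin m) : 0 ≤ choiceProb θ c R j := by
  unfold choiceProb
  split_ifs
  · positivity
  · exact le_rfl
  · exact div_nonneg (Real.rpow_nonneg (hc j) _)
      (Finset.sum_nonneg fun k _ => Real.rpow_nonneg (hc k) _)

lemma plProb_nonneg {m : ℕ} {θ : ℝ} {c : Fin m → ℝ} (hc : ∀ j, 0 ≤ c j) (r : Ranking m) :
    0 ≤ plProb θ c r :=
  Finset.prod_nonneg fun _ _ => choiceProb_nonneg hc _ _

lemma sum_choiceProb_univ {m : ℕ} {θ : ℝ} {c : Fin (m + 1) → ℝ} (hc : ∀ j, 0 ≤ c j) :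
    ∑ j, choiceProb θ c Finset.univ j = 1 := by
  unfold choiceProb
  by_cases h : ∃ k ∈ (Finset.univ : Finset (Fin (m + 1))), c k = 0
  · simp only [if_pos h]
    rw [← Finset.sum_filter, Finset.sum_const, nsmul_eq_mul, mul_one_div_cancel]
    obtain ⟨k, _, hk⟩ := h
    exact_mod_cast (Finset.card_pos.2 ⟨k, by simp [hk]⟩).ne'
  · simp only [if_neg h]
    rw [← Finset.sum_div, div_self]
    refine (Finset.sum_pos (fun k _ => ?_) Finset.univ_nonempty).ne'
    exact Real.rpow_pos_of_pos (lt_of_le_of_ne (hc k) fun h0 => h ⟨k, Finset.mem_univ k, h0.symm⟩) _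

/-- Choice probabilities satisfy Luce's axiom: the conditional probability of choosing `a`, given
that `a` or `b` is chosen, depends on these two candidates only. -/
lemma choiceProb_eq_mul_pairProb {m : ℕ} {θ : ℝ} (hθ : 0 < θ) {c : Fin m → ℝ}
    (hc : ∀ j, 0 ≤ c j) (a b : Fin m) :
    choiceProb θ c Finset.univ a =
      (choiceProb θ c Finset.univ a + choiceProb θ c Finset.univ b) *
        pairProb θ (c a) (c b) := by
  unfold choiceProb pairProb
  by_cases h : ∃ k ∈ (Finset.univ : Finset (Fin m)), c k = 0
  · simp only [if_pos h]
    by_cases ha : c a = 0 <;> by_cases hb : c b = 0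
    · simp only [ha, hb, and_self, if_true]; ring
    · have : (c b) ^ θ ≠ 0 := (Real.rpow_pos_of_pos (lt_of_le_of_ne (hc b) (Ne.symm hb)) _).ne'
      simp [ha, hb, Real.zero_rpow hθ.ne', this]
    · simp [ha, hb, Real.zero_rpow hθ.ne']
    · simp [ha, hb]
  · simp only [if_neg h]
    have hpos : ∀ k, 0 < c k := fun k =>
      lt_of_le_of_ne (hc k) fun h0 => h ⟨k, Finset.mem_univ k, h0.symm⟩
    have hA := Real.rpow_pos_of_pos (hpos a) θ
    have hB := Real.rpow_pos_of_pos (hpos b) θ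
    have hS : 0 < ∑ k, c k ^ (-θ) := Finset.sum_pos
      (fun k _ => Real.rpow_pos_of_pos (hpos k) _) ⟨a, Finset.mem_univ a⟩
    rw [if_neg fun h => (hpos a).ne' h.1, Real.rpow_neg (hc a), Real.rpow_neg (hc b)]
    field_simp
    ring

lemma choiceProb_map {m m' : ℕ} (θ : ℝ) (c : Fin m' → ℝ) (e : Fin m ↪ Fin m')
    (R : Finset (Fin m)) (j : Fin m) :
    choiceProb θ c (R.map e) (e j) = choiceProb θ (c ∘ e) R j := by
  unfold choiceProb
  simp [Finset.filter_map]

/-- The labels `0, …, m - 1` for the candidates that remain when `p` has been removed from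
`m + 1` candidates. They are the ones used by `Equiv.Perm.decomposeFin`. -/
def remaining {m : ℕ} (p : Fin (m + 1)) : Fin m ↪ Fin (m + 1) :=
  (Fin.succEmb m).trans (Equiv.swap 0 p).toEmbedding

lemma remaining_ne {m : ℕ} (p : Fin (m + 1)) (j : Fin m) : remaining p j ≠ p := by
  intro h
  have : (Equiv.swap 0 p) j.succ = (Equiv.swap 0 p) 0 := by
    rw [Equiv.swap_apply_left]; exact h
  exact Fin.succ_ne_zero j ((Equiv.swap 0 p).injective this)

lemma exists_remaining {m : ℕ} {p a : Fin (m + 1)} (h : a ≠ p) : ∃ j, remaining p j = a := by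
  have h0 : Equiv.swap 0 p a ≠ 0 := fun h0 => h <| by
    rwa [← Equiv.eq_symm_apply, Equiv.symm_swap, Equiv.swap_apply_left] at h0
  refine ⟨(Equiv.swap 0 p a).pred h0, ?_⟩
  simp [remaining]

lemma decomposeFin_symm_zero {m : ℕ} (p : Fin (m + 1)) (e : Ranking m) :
    (Equiv.Perm.decomposeFin.symm (p, e)) 0 = p := by simp

lemma decomposeFin_symm_succ {m : ℕ} (p : Fin (m + 1)) (e : Ranking m) (k : Fin m) :
    (Equiv.Perm.decomposeFin.symm (p, e)) k.succ = remaining p (e k) := by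
  simp [remaining]

lemma decomposeFin_symm_symm_top {m : ℕ} (p : Fin (m + 1)) (e : Ranking m) :
    (Equiv.Perm.decomposeFin.symm (p, e)).symm p = 0 := by
  rw [Equiv.symm_apply_eq, decomposeFin_symm_zero]

lemma decomposeFin_symm_symm_remaining {m : ℕ} (p : Fin (m + 1)) (e : Ranking m) (j : Fin m) :
    (Equiv.Perm.decomposeFin.symm (p, e)).symm (remaining p j) = (e.symm j).succ := by
  rw [Equiv.symm_apply_eq, decomposeFin_symm_succ, Equiv.apply_symm_apply]

/-- After the choice of the top candidate, a Plackett–Luce voter ranks the remaining candidates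
according to the Plackett–Luce model. -/
lemma plProb_decomposeFin {m : ℕ} (θ : ℝ) (c : Fin (m + 1) → ℝ) (p : Fin (m + 1))
    (e : Ranking m) :
    plProb θ c (Equiv.Perm.decomposeFin.symm (p, e)) =
      choiceProb θ c Finset.univ p * plProb θ (c ∘ remaining p) e := by
  unfold plProb
  rw [Fin.prod_univ_succ, decomposeFin_symm_zero]
  congr 1
  · simp
  · refine Finset.prod_congr rfl fun k _ => ?_
    rw [decomposeFin_symm_succ, ← choiceProb_map]
    congr 1
    ext a
    simp only [Finset.mem_filter, Finset.mem_univ, true_and, Finset.mem_map]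
    by_cases ha : a = p
    · subst ha
      rw [decomposeFin_symm_symm_top]
      simp [remaining_ne]
    · obtain ⟨j, rfl⟩ := exists_remaining ha
      rw [decomposeFin_symm_symm_remaining]
      simp

lemma sum_ranking_succ {m : ℕ} (F : Ranking (m + 1) → ℝ) :
    ∑ r, F r = ∑ p, ∑ e : Ranking m, F (Equiv.Perm.decomposeFin.symm (p, e)) := by
  rw [← Equiv.sum_comp Equiv.Perm.decomposeFin.symm F, Fintype.sum_prod_type]

lemma sum_plProb {m : ℕ} {θ : ℝ} {c : Fin m → ℝ} (hc : ∀ j, 0 ≤ c j) :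
    ∑ r, plProb θ c r = 1 := by
  induction m with
  | zero => simp [plProb]
  | succ m ih =>
    rw [sum_ranking_succ]
    simp_rw [plProb_decomposeFin, ← Finset.mul_sum]
    rw [← sum_choiceProb_univ (θ := θ) hc]
    exact Finset.sum_congr rfl fun p _ => by
      rw [ih (c := c ∘ remaining p) fun j => hc _, mul_one]

/-- The pairwise marginals of the Plackett–Luce model. -/
lemma sum_plProb_above {m : ℕ} {θ : ℝ} (hθ : 0 < θ) {c : Fin m → ℝ} (hc : ∀ j, 0 ≤ c j)
    {a b : Fin m} (hab : a ≠ b) :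
    ∑ r, plProb θ c r * (if r.Above a b then 1 else 0) = pairProb θ (c a) (c b) := by
  induction m with
  | zero => exact a.elim0
  | succ m ih =>
    rw [sum_ranking_succ]
    have key : ∀ p, ∑ e : Ranking m, plProb θ c (Equiv.Perm.decomposeFin.symm (p, e)) *
        (if Ranking.Above (Equiv.Perm.decomposeFin.symm (p, e)) a b then (1 : ℝ) else 0) =
        choiceProb θ c Finset.univ p * pairProb θ (c a) (c b) +
          ((if p = a then choiceProb θ c Finset.univ a * (1 - pairProb θ (c a) (c b)) else 0) -
          (if p = b then choiceProb θ c Finset.univ b * pairProb θ (c a) (c b) else 0)) := by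
      intro p
      simp_rw [plProb_decomposeFin, mul_assoc, ← Finset.mul_sum]
      by_cases hpa : p = a
      · subst hpa
        have : ∀ e : Ranking m, Ranking.Above (Equiv.Perm.decomposeFin.symm (p, e)) p b := by
          intro e
          obtain ⟨j, rfl⟩ := exists_remaining hab.symm
          unfold Ranking.Above
          rw [decomposeFin_symm_symm_top, decomposeFin_symm_symm_remaining]
          exact Fin.succ_pos _
        simp only [this, if_true, mul_one, if_neg hab]
        rw [sum_plProb (c := c ∘ remaining p) fun j => hc _]; ring
      by_cases hpb : p = b
      · subst hpb
        have : ∀ e : Ranking m, ¬ Ranking.Above (Equiv.Perm.decomposeFin.symm (p, e)) a p := by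
          intro e
          unfold Ranking.Above
          rw [decomposeFin_symm_symm_top]
          simp
        simp only [this, if_false, mul_zero, Finset.sum_const_zero, if_neg hpa, if_true]
        ring
      · obtain ⟨a', ha'⟩ := exists_remaining (Ne.symm hpa)
        obtain ⟨b', hb'⟩ := exists_remaining (Ne.symm hpb)
        have hab' : a' ≠ b' := fun h => hab (by rw [← ha', ← hb', h])
        have := ih (c := c ∘ remaining p) (fun j => hc _) hab'
        simp only [Function.comp_apply, ha', hb'] at this
        rw [if_neg hpa, if_neg hpb, ← this, sub_zero, add_zero]
        congr 1
        refine Finset.sum_congr rfl fun e _ => ?_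
        congr 1
        have : Ranking.Above (Equiv.Perm.decomposeFin.symm (p, e)) a b ↔ e.Above a' b' := by
          unfold Ranking.Above
          rw [← ha', ← hb', decomposeFin_symm_symm_remaining, decomposeFin_symm_symm_remaining,
            Fin.succ_lt_succ_iff]
        simp only [this]
    rw [Finset.sum_congr rfl fun p _ => key p, Finset.sum_add_distrib, ← Finset.sum_mul,
      sum_choiceProb_univ hc, Finset.sum_sub_distrib]
    simp only [Finset.sum_ite_eq', Finset.mem_univ, if_true]
    have := choiceProb_eq_mul_pairProb hθ hc a b
    linarith

lemma pairProb_of_left_ne {θ x : ℝ} (hx : x ≠ 0) (y : ℝ) :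
    pairProb θ x y = y ^ θ / (x ^ θ + y ^ θ) := if_neg fun h => hx h.1

lemma pairProb_of_right_ne {θ y : ℝ} (x : ℝ) (hy : y ≠ 0) :
    pairProb θ x y = y ^ θ / (x ^ θ + y ^ θ) := if_neg fun h => hy h.2

lemma pairProb_nonneg {θ x y : ℝ} (hx : 0 ≤ x) (hy : 0 ≤ y) : 0 ≤ pairProb θ x y := by
  unfold pairProb
  split_ifs <;> positivity

lemma pairProb_add_swap {θ x y : ℝ} (hx : 0 ≤ x) (hy : 0 ≤ y) :
    pairProb θ x y + pairProb θ y x = 1 := by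
  by_cases h : x = 0 ∧ y = 0
  · simp only [pairProb, h, and_self, if_true]; norm_num
  · have h' : ¬ (y = 0 ∧ x = 0) := fun h' => h h'.symm
    have : x ^ θ + y ^ θ ≠ 0 := by
      rcases hx.eq_or_lt with h0 | h0
      · have : 0 < y := lt_of_le_of_ne hy fun h1 => h ⟨h0.symm, h1.symm⟩
        positivity
      · positivity
    rw [pairProb, pairProb, if_neg h, if_neg h', add_comm (y ^ θ), ← add_div, add_comm (y ^ θ),
      div_self this]

lemma pairProb_le_one {θ x y : ℝ} (hx : 0 ≤ x) (hy : 0 ≤ y) : pairProb θ x y ≤ 1 := by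
  have := pairProb_add_swap (θ := θ) hx hy
  have := pairProb_nonneg (θ := θ) hy hx
  linarith

lemma pairProb_self {θ x : ℝ} (hx : 0 ≤ x) : pairProb θ x x = 1 / 2 := by
  have := pairProb_add_swap (θ := θ) hx hx
  linarith

lemma pairProb_zero_left {θ y : ℝ} (hθ : 0 < θ) (hy : 0 < y) : pairProb θ 0 y = 1 := by
  rw [pairProb_of_right_ne _ hy.ne', Real.zero_rpow hθ.ne', zero_add,
    div_self (Real.rpow_pos_of_pos hy _).ne']

lemma pairProb_zero_right {θ x : ℝ} (hθ : 0 < θ) (hx : 0 < x) : pairProb θ x 0 = 0 := by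
  rw [pairProb_of_left_ne hx.ne', Real.zero_rpow hθ.ne', zero_div]

/-- A candidate farther from the voter is less likely to be ranked above a given candidate. -/
lemma pairProb_anti_left {θ x x' y : ℝ} (hθ : 0 < θ) (hx : 0 ≤ x) (hxx : x ≤ x') (hy : 0 ≤ y) :
    pairProb θ x' y ≤ pairProb θ x y := by
  rcases hx.eq_or_lt with rfl | hx0
  · rcases hy.eq_or_lt with rfl | hy0
    · rcases hxx.eq_or_lt with rfl | hx'
      · exact le_rfl
      · rw [pairProb_zero_right hθ hx']; exact pairProb_nonneg le_rfl le_rfl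
    · rw [pairProb_zero_left hθ hy0]; exact pairProb_le_one hxx hy
  · rw [pairProb_of_left_ne hx0.ne', pairProb_of_left_ne (hx0.trans_le hxx).ne']
    have := Real.rpow_le_rpow hx hxx hθ.le
    gcongr

lemma pairProb_scale {θ x y s : ℝ} (hx : 0 ≤ x) (hy : 0 ≤ y) (hs : 0 < s) :
    pairProb θ (x / s) (y / s) = pairProb θ x y := by
  unfold pairProb
  have hs' := Real.rpow_pos_of_pos hs θ
  simp only [div_eq_zero_iff, hs.ne', or_false]
  split_ifs
  · rfl
  · rw [Real.div_rpow hx hs.le, Real.div_rpow hy hs.le, ← add_div, div_div_div_cancel_right₀ hs'.ne']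

/-! ### Sums of independent variables with finitely many values -/

section Product

variable {ι R : Type*} [Fintype ι] [DecidableEq ι] [Fintype R] {p : ι → R → ℝ}

lemma sum_prod_pi_eq_one (hp : ∀ i, ∑ r, p i r = 1) : ∑ σ : ι → R, ∏ i, p i (σ i) = 1 := by
  rw [← Fintype.prod_sum]
  simp [hp]

lemma sum_prod_pi_mul_mul_eq_zero {i i' : ι} (hi : i ≠ i') {g h : R → ℝ}
    (hg : ∑ r, p i r * g r = 0) :
    ∑ σ : ι → R, (∏ k, p k (σ k)) * (g (σ i) * h (σ i')) = 0 := by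
  have key : ∀ σ : ι → R, (∏ k, p k (σ k)) * (g (σ i) * h (σ i')) =
      ∏ k, p k (σ k) * ((if k = i then g (σ k) else 1) * (if k = i' then h (σ k) else 1)) := by
    intro σ
    rw [Finset.prod_mul_distrib, Finset.prod_mul_distrib]
    simp
  simp_rw [key]
  rw [← Fintype.prod_sum fun k r => p k r * ((if k = i then g r else 1) * (if k = i' then h r else 1))]
  refine Finset.prod_eq_zero (Finset.mem_univ i) ?_
  simpa [hi] using hg

lemma sum_prod_pi_mul_single (hp : ∀ i, ∑ r, p i r = 1) (i : ι) (g : R → ℝ) :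
    ∑ σ : ι → R, (∏ k, p k (σ k)) * g (σ i) = ∑ r, p i r * g r := by
  have key : ∀ σ : ι → R, (∏ k, p k (σ k)) * g (σ i) =
      ∏ k, p k (σ k) * (if k = i then g (σ k) else 1) := by
    intro σ
    rw [Finset.prod_mul_distrib]
    simp
  simp_rw [key]
  rw [← Fintype.prod_sum fun k r => p k r * (if k = i then g r else 1)]
  rw [Finset.prod_eq_single i]
  · simp
  · intro k _ hk
    simp [hk, hp]
  · simp

/-- The variance of a sum of independent centered variables is the sum of the variances. -/
lemma sum_prod_pi_mul_sq (hp : ∀ i, ∑ r, p i r = 1) {g : ι → R → ℝ}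
    (hg : ∀ i, ∑ r, p i r * g i r = 0) :
    ∑ σ : ι → R, (∏ k, p k (σ k)) * (∑ i, g i (σ i)) ^ 2 = ∑ i, ∑ r, p i r * g i r ^ 2 := by
  simp_rw [sq, Finset.sum_mul_sum, Finset.mul_sum]
  rw [Finset.sum_comm]
  refine Finset.sum_congr rfl fun i _ => ?_
  rw [Finset.sum_comm, Finset.sum_eq_single i]
  · exact sum_prod_pi_mul_single hp i fun r => g i r * g i r
  · intro i' _ hi'
    exact sum_prod_pi_mul_mul_eq_zero hi'.symm (hg i)
  · simp

/-- Chebyshev's inequality, for an event (or a weight `u`) under which a sum of independent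
variables deviates from its mean by at least `t`. -/
lemma sum_prod_pi_mul_le_of_deviation (hp0 : ∀ i r, 0 ≤ p i r) (hp : ∀ i, ∑ r, p i r = 1)
    (h : ι → R → ℝ) {u : (ι → R) → ℝ} (hu : ∀ σ, u σ ≤ 1) {t : ℝ} (ht : 0 < t)
    (hdev : ∀ σ, u σ ≠ 0 → t ≤ |∑ i, h i (σ i) - ∑ i, ∑ r, p i r * h i r|) :
    ∑ σ : ι → R, (∏ i, p i (σ i)) * u σ ≤ (∑ i, ∑ r, p i r * h i r ^ 2) / t ^ 2 := by
  set μ : ι → ℝ := fun i => ∑ r, p i r * h i r with hμ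
  have hc : ∀ i, ∑ r, p i r * (h i r - μ i) = 0 := by
    intro i
    simp_rw [mul_sub]
    rw [Finset.sum_sub_distrib, ← Finset.sum_mul, hp, one_mul, sub_self]
  have hvar : ∀ i, ∑ r, p i r * (h i r - μ i) ^ 2 ≤ ∑ r, p i r * h i r ^ 2 := by
    intro i
    have : ∑ r, p i r * (h i r - μ i) ^ 2 = ∑ r, p i r * h i r ^ 2 - μ i ^ 2 := by
      have : ∀ r, p i r * (h i r - μ i) ^ 2 =
          p i r * h i r ^ 2 - 2 * μ i * (p i r * h i r) + μ i ^ 2 * p i r := fun r => by ring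
      simp_rw [this]
      rw [Finset.sum_add_distrib, Finset.sum_sub_distrib, ← Finset.mul_sum, ← Finset.mul_sum, hp]
      simp only [hμ]; ring
    rw [this]; nlinarith [sq_nonneg (μ i)]
  rw [le_div_iff₀ (by positivity), Finset.sum_mul]
  refine le_trans ?_ (Finset.sum_le_sum fun i _ => hvar i)
  rw [← sum_prod_pi_mul_sq hp hc]
  refine Finset.sum_le_sum fun σ _ => ?_
  rw [mul_assoc]
  refine mul_le_mul_of_nonneg_left ?_ (Finset.prod_nonneg fun i _ => hp0 i _)
  rw [Finset.sum_sub_distrib]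
  by_cases h0 : u σ = 0
  · rw [h0, zero_mul]; positivity
  · calc u σ * t ^ 2 ≤ 1 * t ^ 2 := mul_le_mul_of_nonneg_right (hu σ) (by positivity)
      _ = t ^ 2 := one_mul _
      _ ≤ |∑ i, h i (σ i) - ∑ i, μ i| ^ 2 := pow_le_pow_left₀ ht.le (hdev σ h0) 2
      _ = _ := sq_abs _

end Product

/-! ### Election probabilities -/

lemma cost_nonneg {n m : ℕ} (D : PseudoMetricSpace (Fin n ⊕ Fin m)) (i : Fin n) (j : Fin m) :
    0 ≤ cost D i j := by
  let _ := D
  exact dist_nonneg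

lemma socialCost_nonneg {n m : ℕ} (D : PseudoMetricSpace (Fin n ⊕ Fin m)) (j : Fin m) :
    0 ≤ socialCost D j := Finset.sum_nonneg fun i _ => cost_nonneg D i j

/-- The number of candidates that the ranking `r` places below `a`, as a real number. -/
noncomputable def bordaPoints {m : ℕ} (a : Fin m) (r : Ranking m) : ℝ :=
  ∑ b ∈ Finset.univ.erase a, if r.Above a b then 1 else 0

lemma bordaScore_eq_sum {n m : ℕ} (σ : Profile n m) (a : Fin m) :
    (bordaScore σ a : ℝ) = ∑ i, bordaPoints a (σ i) := by
  unfold bordaScore bordaPoints pairwiseVotes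
  push_cast [Finset.card_filter]
  rw [Finset.sum_comm]

lemma bordaPoints_nonneg {m : ℕ} (a : Fin m) (r : Ranking m) : 0 ≤ bordaPoints a r :=
  Finset.sum_nonneg fun _ _ => by split_ifs <;> norm_num

lemma bordaPoints_le {m : ℕ} (a : Fin m) (r : Ranking m) : bordaPoints a r ≤ m - 1 := by
  have hm : 1 ≤ m := Nat.one_le_of_lt a.isLt
  calc bordaPoints a r ≤ ∑ b ∈ Finset.univ.erase a, (1 : ℝ) :=
        Finset.sum_le_sum fun _ _ => by split_ifs <;> norm_num
    _ = m - 1 := by simp [Finset.card_erase_of_mem, hm]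

lemma bordaPoints_lt {m : ℕ} {a b : Fin m} {r : Ranking m} (h : r.Above a b) :
    bordaPoints b r + 1 ≤ bordaPoints a r := by
  have hab : a ≠ b := by rintro rfl; exact lt_irrefl _ h
  have h1 : bordaPoints a r = 1 + ∑ x ∈ (Finset.univ.erase a).erase b,
      if r.Above a x then (1 : ℝ) else 0 := by
    unfold bordaPoints
    rw [← Finset.add_sum_erase _ _ (Finset.mem_erase.2 ⟨hab.symm, Finset.mem_univ b⟩), if_pos h]
  have h2 : bordaPoints b r = ∑ x ∈ (Finset.univ.erase b).erase a,
      if r.Above b x then (1 : ℝ) else 0 := by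
    unfold bordaPoints
    rw [← Finset.add_sum_erase _ _ (Finset.mem_erase.2 ⟨hab, Finset.mem_univ a⟩),
      if_neg (show ¬ r.Above b a from not_lt_of_gt h), zero_add]
  rw [h1, h2, Finset.erase_right_comm, add_comm]
  gcongr with x _
  by_cases hb : r.Above b x
  · rw [if_pos hb, if_pos (show r.Above a x from lt_trans h hb)]
  · rw [if_neg hb]; split_ifs <;> norm_num

/-- The expected share of a candidate at distance `x` in a comparison with each of the candidates
in turn. The comparison of a candidate with itself counts `1 / 2`. -/
noncomputable def share {m : ℕ} (θ : ℝ) (c : Fin m → ℝ) (x : ℝ) : ℝ := ∑ b, pairProb θ x (c b)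

lemma share_anti {m : ℕ} {θ : ℝ} (hθ : 0 < θ) {c : Fin m → ℝ} (hc : ∀ j, 0 ≤ c j) {x y : ℝ}
    (hx : 0 ≤ x) (hxy : x ≤ y) : share θ c y ≤ share θ c x :=
  Finset.sum_le_sum fun b _ => pairProb_anti_left hθ hx hxy (hc b)

/-- The expected Borda points of a candidate, from a single Plackett–Luce voter. -/
lemma sum_plProb_bordaPoints {m : ℕ} {θ : ℝ} (hθ : 0 < θ) {c : Fin m → ℝ} (hc : ∀ j, 0 ≤ c j)
    (a : Fin m) : ∑ r, plProb θ c r * bordaPoints a r = share θ c (c a) - 1 / 2 := by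
  unfold bordaPoints share
  simp_rw [Finset.mul_sum]
  rw [Finset.sum_comm, ← Finset.add_sum_erase _ _ (Finset.mem_univ a), pairProb_self (hc a),
    add_sub_cancel_left]
  exact Finset.sum_congr rfl fun b hb => sum_plProb_above hθ hc (Finset.ne_of_mem_erase hb).symm

/-- The expected Borda score of a candidate, shifted by half the number of voters: for each voter,
the comparison of the candidate with itself is counted as `1 / 2`. -/
noncomputable def expectedBorda {n m : ℕ} (θ : ℝ) (D : PseudoMetricSpace (Fin n ⊕ Fin m))
    (j : Fin m) : ℝ := ∑ i, share θ (cost D i) (cost D i j)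

/-- The probability that candidate `j` is elected. -/
noncomputable def winProb {n m : ℕ} (θ : ℝ) (D : PseudoMetricSpace (Fin n ⊕ Fin m))
    (f : VotingRule n m) (j : Fin m) : ℝ := ∑ σ, profileProb θ D σ * (f σ j).toReal

section Win

variable {n m : ℕ} {θ : ℝ} {D : PseudoMetricSpace (Fin n ⊕ Fin m)} {f : VotingRule n m}

lemma expectedCost_eq_sum_winProb :
    expectedCost θ D f = ∑ j, winProb θ D f j * socialCost D j := by
  unfold expectedCost winProb
  simp_rw [Finset.mul_sum, Finset.sum_mul, mul_assoc]
  rw [Finset.sum_comm]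

lemma profileProb_nonneg (σ : Profile n m) : 0 ≤ profileProb θ D σ :=
  Finset.prod_nonneg fun i _ => plProb_nonneg (cost_nonneg D i) _

lemma winProb_nonneg (j : Fin m) : 0 ≤ winProb θ D f j :=
  Finset.sum_nonneg fun _ _ => mul_nonneg (profileProb_nonneg _) ENNReal.toReal_nonneg

lemma toReal_pmf_le_one {α : Type*} (P : PMF α) (a : α) : (P a).toReal ≤ 1 :=
  ENNReal.toReal_le_of_le_ofReal zero_le_one (by simpa using P.coe_le_one a)

lemma sum_toReal_pmf {α : Type*} [Fintype α] (P : PMF α) : ∑ a, (P a).toReal = 1 := by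
  rw [← ENNReal.toReal_sum fun a _ => P.apply_ne_top a, ← tsum_fintype (L := .unconditional _),
    P.tsum_coe, ENNReal.toReal_one]

lemma sum_winProb : ∑ j, winProb θ D f j = 1 := by
  unfold winProb
  rw [Finset.sum_comm]
  simp_rw [← Finset.mul_sum, sum_toReal_pmf, mul_one]
  exact sum_prod_pi_eq_one fun i => sum_plProb (cost_nonneg D i)

/-- A candidate whose expected Borda score is smaller than that of another candidate by `t` is
elected with probability at most `n * m ^ 2 / t ^ 2`. -/
lemma winProb_le_of_gap (hθ : 0 < θ) (hf : IsBordaRule f) {j c : Fin m} {t : ℝ} (ht : 0 < t)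
    (hgap : expectedBorda θ D j + t ≤ expectedBorda θ D c) :
    winProb θ D f j ≤ n * m ^ 2 / t ^ 2 := by
  have hp := fun i => sum_plProb (θ := θ) (cost_nonneg D i)
  have hp0 := fun i => plProb_nonneg (θ := θ) (cost_nonneg D i)
  set h : Fin n → Ranking m → ℝ := fun _ r => bordaPoints c r - bordaPoints j r
  have hmean : ∑ i, ∑ r, plProb θ (cost D i) r * h i r =
      expectedBorda θ D c - expectedBorda θ D j := by
    unfold expectedBorda
    rw [← Finset.sum_sub_distrib]
    refine Finset.sum_congr rfl fun i _ => ?_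
    simp_rw [h, mul_sub]
    rw [Finset.sum_sub_distrib, sum_plProb_bordaPoints hθ (cost_nonneg D i),
      sum_plProb_bordaPoints hθ (cost_nonneg D i)]
    ring
  have hsq : ∀ i, ∑ r, plProb θ (cost D i) r * h i r ^ 2 ≤ (m : ℝ) ^ 2 := by
    intro i
    rw [← one_mul ((m : ℝ) ^ 2), ← hp i, Finset.sum_mul]
    refine Finset.sum_le_sum fun r _ => mul_le_mul_of_nonneg_left ?_ (hp0 i r)
    have h1 := bordaPoints_nonneg c r
    have h2 := bordaPoints_nonneg j r
    have h3 := bordaPoints_le c r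
    have h4 := bordaPoints_le j r
    exact sq_le_sq' (by simp only [h]; linarith) (by simp only [h]; linarith)
  refine (sum_prod_pi_mul_le_of_deviation (p := fun i => plProb θ (cost D i)) hp0 hp h
    (u := fun σ => (f σ j).toReal) (fun σ => toReal_pmf_le_one _ _) ht ?_).trans ?_
  · intro σ hσ
    have hmem : j ∈ (f σ).support := by
      rw [PMF.mem_support_iff]; intro h0; exact hσ (by simp [h0])
    have hle : (bordaScore σ c : ℝ) ≤ bordaScore σ j := by exact_mod_cast hf σ j hmem c
    rw [bordaScore_eq_sum, bordaScore_eq_sum] at hle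
    rw [hmean, Finset.sum_sub_distrib, abs_sub_comm]
    exact le_trans (by linarith) (le_abs_self _)
  · gcongr
    calc _ ≤ ∑ i : Fin n, (m : ℝ) ^ 2 := Finset.sum_le_sum fun i _ => hsq i
      _ = n * m ^ 2 := by simp

/-- A candidate can only win if a fraction `1 / m` of the voters ranks it above `k`. It does so
with small probability if the expected number of these voters is at most half as large. -/
lemma winProb_le_of_few_votes (hθ : 0 < θ) (hf : IsBordaRule f) (hn : 0 < n) {j k : Fin m}
    (hjk : j ≠ k)
    (hfew : ∑ i, pairProb θ (cost D i j) (cost D i k) ≤ n / (2 * m)) :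
    winProb θ D f j ≤ (∑ i, pairProb θ (cost D i j) (cost D i k)) / (n / (2 * m)) ^ 2 := by
  have hm : (0 : ℝ) < m := by exact_mod_cast Nat.lt_of_le_of_lt (Nat.zero_le _) j.isLt
  have hn' : (0 : ℝ) < n := by exact_mod_cast hn
  have hp := fun i => sum_plProb (θ := θ) (cost_nonneg D i)
  have hp0 := fun i => plProb_nonneg (θ := θ) (cost_nonneg D i)
  set h : Fin n → Ranking m → ℝ := fun _ r => if r.Above j k then 1 else 0
  have hmean : ∀ i, ∑ r, plProb θ (cost D i) r * h i r = pairProb θ (cost D i j) (cost D i k) :=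
    fun i => sum_plProb_above hθ (cost_nonneg D i) hjk
  have hsq : ∀ i, ∑ r, plProb θ (cost D i) r * h i r ^ 2 =
      pairProb θ (cost D i j) (cost D i k) := by
    intro i
    rw [← hmean]
    refine Finset.sum_congr rfl fun r _ => ?_
    simp only [h]; split_ifs <;> norm_num
  refine (sum_prod_pi_mul_le_of_deviation (p := fun i => plProb θ (cost D i)) hp0 hp h
    (u := fun σ => (f σ j).toReal) (t := n / (2 * m)) (fun σ => toReal_pmf_le_one _ _)
    (by positivity) ?_).trans_eq (by simp_rw [hsq])
  intro σ hσ
  have hmem : j ∈ (f σ).support := by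
    rw [PMF.mem_support_iff]; intro h0; exact hσ (by simp [h0])
  have hle : (bordaScore σ k : ℝ) ≤ bordaScore σ j := by exact_mod_cast hf σ j hmem k
  rw [bordaScore_eq_sum, bordaScore_eq_sum] at hle
  have hvote : ∀ i, bordaPoints j (σ i) - bordaPoints k (σ i) ≤ m * h i (σ i) - 1 := by
    intro i
    by_cases hi : (σ i).Above j k
    · simp only [h, if_pos hi]
      linarith [bordaPoints_le j (σ i), bordaPoints_nonneg k (σ i)]
    · have hi' : (σ i).Above k j := by
        refine lt_of_le_of_ne (not_lt.1 hi) fun h0 => hjk ?_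
        exact ((σ i).symm.injective h0).symm
      simp only [h, if_neg hi]
      linarith [bordaPoints_lt hi']
  have hsum := Finset.sum_le_sum fun i (_ : i ∈ (Finset.univ : Finset (Fin n))) => hvote i
  rw [Finset.sum_sub_distrib, Finset.sum_sub_distrib, ← Finset.mul_sum] at hsum
  simp only [Finset.sum_const, Finset.card_univ, Fintype.card_fin, nsmul_eq_mul, mul_one] at hsum
  have hN : (n : ℝ) / m ≤ ∑ i, h i (σ i) := by
    rw [div_le_iff₀ hm]; linarith
  refine le_trans ?_ (le_abs_self _)
  simp_rw [hmean]
  have : (n : ℝ) / m = n / (2 * m) + n / (2 * m) := by field_simp; norm_num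
  linarith

end Win

/-! ### Estimates for a single voter -/

lemma pairProb_le_div {θ x y : ℝ} (hθ : 1 ≤ θ) (hy : 0 ≤ y) (hyx : y ≤ x) (hx : 0 < x) :
    pairProb θ x y ≤ y / (x + y) := by
  rw [pairProb_of_left_ne hx.ne', div_le_div_iff₀ (by positivity) (by positivity)]
  have h1 : (y / x) ^ θ ≤ y / x :=
    Real.rpow_le_self_of_le_one (by positivity) ((div_le_one hx).2 hyx) hθ
  rw [Real.div_rpow hy hx.le, div_le_div_iff₀ (by positivity) hx] at h1
  linarith

lemma pairProb_sub_le {θ y w z : ℝ} (hθ : 0 < θ) (hy : 0 ≤ y) (hyw : y < w) (hz : 0 ≤ z) :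
    pairProb θ y z - pairProb θ w z ≤ (w ^ θ - y ^ θ) / (w ^ θ + z ^ θ) := by
  have hw : 0 < w := hy.trans_lt hyw
  have hW := Real.rpow_pos_of_pos hw θ
  have hZ := Real.rpow_nonneg hz θ
  have hWZ : 0 < w ^ θ + z ^ θ := by linarith
  rw [pairProb_of_left_ne hw.ne', sub_le_iff_le_add, ← add_div]
  rcases hy.eq_or_lt with rfl | hy0
  · rw [Real.zero_rpow hθ.ne', sub_zero, div_self hWZ.ne']
    exact pairProb_le_one le_rfl hz
  · have hY := Real.rpow_pos_of_pos hy0 θ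
    have hYW : y ^ θ ≤ w ^ θ := Real.rpow_le_rpow hy hyw.le hθ.le
    rw [pairProb_of_left_ne hy0.ne', div_le_div_iff₀ (by linarith) hWZ]
    nlinarith

/-- The tangent line bound `w ^ θ - y ^ θ ≤ θ * w ^ (θ - 1) * (w - y)`, by convexity. -/
lemma rpow_sub_rpow_le {θ y w : ℝ} (hθ : 1 ≤ θ) (hy : 0 ≤ y) (hw : 0 < w) :
    w ^ θ - y ^ θ ≤ θ * w ^ (θ - 1) * (w - y) := by
  have h := one_add_mul_self_le_rpow_one_add (s := y / w - 1) (by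
    have : 0 ≤ y / w := by positivity
    linarith) hθ
  rw [add_sub_cancel, Real.div_rpow hy hw.le, le_div_iff₀ (by positivity)] at h
  rw [Real.rpow_sub_one hw.ne']
  have : (1 + θ * (y / w - 1)) * w ^ θ = w ^ θ - θ * (w ^ θ / w) * (w - y) := by
    field_simp; ring
  linarith

lemma rpow_mul_rpow_le_of_le {θ α w T A : ℝ} (hw : 0 < w) (hT : 0 < T) (hα : 0 ≤ α) (hαθ : α ≤ θ)
    (h1 : w ^ θ ≤ A) (h2 : T ^ θ ≤ A) : w ^ (θ - α) * T ^ α ≤ A := by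
  rcases le_total w T with h | h
  · calc w ^ (θ - α) * T ^ α ≤ T ^ (θ - α) * T ^ α := by gcongr
      _ = T ^ θ := by rw [← Real.rpow_add hT, sub_add_cancel]
      _ ≤ A := h2
  · calc w ^ (θ - α) * T ^ α ≤ w ^ (θ - α) * w ^ α := by gcongr
      _ = w ^ θ := by rw [← Real.rpow_add hw, sub_add_cancel]
      _ ≤ A := h1

/-- The distances `y`, `w`, `z` are those of a voter close to `k` from `j`, from a candidate `c` near
`k`, and from a candidate at distance `t` from `k`, where `d(j, k) = 1`. In the comparison with the
last candidate, the loss of `j` relative to `c` is at least of order `t ^ (-θ)`. -/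
lemma exists_far_loss {θ : ℝ} (hθ : 1 < θ) : ∃ κ : ℝ, 0 < κ ∧ ∀ y w z t : ℝ, 7 / 8 ≤ y → 0 ≤ w →
    w ≤ 3 / 8 → 1 / 4 < t → t / 2 ≤ z → z ≤ 3 / 2 * t →
    pairProb θ y z - pairProb θ w z ≤ -(κ * t ^ (-θ)) := by
  have hθ0 : 0 < θ := by linarith
  have hab : (3 / 8 : ℝ) ^ θ < (7 / 8 : ℝ) ^ θ :=
    Real.rpow_lt_rpow (by norm_num) (by norm_num) hθ0
  set a : ℝ := (7 / 8 : ℝ) ^ θ with ha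
  set b : ℝ := (3 / 8 : ℝ) ^ θ with hb
  have hb0 : 0 < b := by positivity
  have ha0 : 0 < a := by positivity
  set K : ℝ := (1 + 7 ^ θ) * (1 + 3 ^ θ) * (3 / 2) ^ θ with hK
  have hK0 : 0 < K := by positivity
  refine ⟨(a - b) / K, div_pos (by linarith) hK0, fun y w z t hy hw hw' ht hz hz' => ?_⟩
  have hz0 : 0 < z := by linarith
  have ht0 : 0 < t := by linarith
  have h1 : pairProb θ y z ≤ z ^ θ / (a + z ^ θ) := by
    refine (pairProb_anti_left hθ0 (by norm_num) hy hz0.le).trans_eq ?_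
    rw [pairProb_of_left_ne (by norm_num)]
  have h2 : z ^ θ / (b + z ^ θ) ≤ pairProb θ w z := by
    refine Eq.trans_le ?_ (pairProb_anti_left hθ0 hw hw' hz0.le)
    rw [pairProb_of_left_ne (by norm_num)]
  have hZ : 0 < z ^ θ := by positivity
  have h3 : a ≤ 7 ^ θ * z ^ θ := by
    rw [← Real.mul_rpow (by norm_num) hz0.le]
    exact Real.rpow_le_rpow (by norm_num) (by linarith) hθ0.le
  have h4 : b ≤ 3 ^ θ * z ^ θ := by
    rw [← Real.mul_rpow (by norm_num) hz0.le]
    exact Real.rpow_le_rpow (by norm_num) (by linarith) hθ0.le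
  have h5 : z ^ θ ≤ (3 / 2) ^ θ * t ^ θ := by
    rw [← Real.mul_rpow (by norm_num) ht0.le]
    exact Real.rpow_le_rpow hz0.le hz' hθ0.le
  have key : (a - b) / K * t ^ (-θ) ≤ z ^ θ / (b + z ^ θ) - z ^ θ / (a + z ^ θ) := by
    have e1 : z ^ θ / (b + z ^ θ) - z ^ θ / (a + z ^ θ) =
        (a - b) * (z ^ θ / ((b + z ^ θ) * (a + z ^ θ))) := by
      field_simp; ring
    rw [e1, div_mul_eq_mul_div, mul_div_assoc]
    refine mul_le_mul_of_nonneg_left ?_ (by linarith)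
    rw [Real.rpow_neg ht0.le, div_le_div_iff₀ hK0 (by positivity), ← div_eq_inv_mul,
      div_le_iff₀ (by positivity)]
    calc (b + z ^ θ) * (a + z ^ θ)
        ≤ (3 ^ θ * z ^ θ + z ^ θ) * (7 ^ θ * z ^ θ + z ^ θ) := by gcongr
      _ = (1 + 7 ^ θ) * (1 + 3 ^ θ) * z ^ θ * z ^ θ := by ring
      _ ≤ (1 + 7 ^ θ) * (1 + 3 ^ θ) * z ^ θ * ((3 / 2) ^ θ * t ^ θ) := by gcongr
      _ = z ^ θ * K * t ^ θ := by rw [hK]; ring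
  linarith

/-- The distances `x`, `y`, `w`, `z` are those of a voter not close to `k` from `k`, from `j`, from a
candidate `c` at distance `s ≤ 1 / 4` from `k`, and from a candidate at distance `t` from `k`, where
`d(j, k) = 1`. In the comparison with the last candidate, `j` gains over `c` at most in proportion
to `x`. -/
lemma exists_far_gain {θ : ℝ} (hθ : 1 < θ) : ∃ K : ℝ, 0 < K ∧ ∀ α y w z t x s : ℝ, 1 ≤ α → α ≤ 2 →
    α ≤ θ → 1 / 8 ≤ x → 0 ≤ y → 0 ≤ w → 0 ≤ z → s ≤ 1 / 4 → w ≤ x + s → x ≤ w + s →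
    w ≤ y + s + 1 → 1 / 4 < t → t ≤ z + x →
    pairProb θ y z - pairProb θ w z ≤ K * (x * t ^ (-α)) := by
  have hθ0 : 0 < θ := by linarith
  have h6 : (0 : ℝ) < 6 ^ θ := by positivity
  refine ⟨128 + 8 * 6 ^ θ + 15 * θ, by positivity, ?_⟩
  intro α y w z t x s hα1 hα2 hαθ hx hy hw hz hs hwx hxw hwy ht htz
  have hx0 : 0 < x := by linarith
  have ht0 : 0 < t := by linarith
  have hP : 0 < x * t ^ (-α) := by positivity
  rcases le_or_gt w y with h | h
  · have := pairProb_anti_left hθ0 hw h hz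
    have : 0 < (128 + 8 * 6 ^ θ + 15 * θ) * (x * t ^ (-α)) := by positivity
    linarith
  have hw0 : 0 < w := hy.trans_lt h
  have hW : 0 < w ^ θ := by positivity
  have hZ : 0 ≤ z ^ θ := by positivity
  have hY : 0 ≤ y ^ θ := by positivity
  have hG := pairProb_sub_le hθ0 hy h hz
  -- It suffices to bound the gain by one of the three summands of the constant.
  have hred : ∀ k : ℝ, k ≤ 128 + 8 * 6 ^ θ + 15 * θ →
      pairProb θ y z - pairProb θ w z ≤ k * (x * t ^ (-α)) →
      pairProb θ y z - pairProb θ w z ≤ (128 + 8 * 6 ^ θ + 15 * θ) * (x * t ^ (-α)) :=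
    fun k hk h => h.trans (mul_le_mul_of_nonneg_right hk hP.le)
  rcases le_or_gt x 1 with hx1 | hx1
  · rcases le_or_gt t 4 with ht4 | ht4
    · refine hred 128 (by linarith) ?_
      have h1 : t ^ α ≤ 16 := by
        calc t ^ α ≤ 4 ^ α := Real.rpow_le_rpow ht0.le ht4 (by linarith)
          _ ≤ 4 ^ (2 : ℝ) := Real.rpow_le_rpow_of_exponent_le (by norm_num) hα2
          _ = 16 := by norm_num
      have h2 : 1 / 16 ≤ t ^ (-α) := by
        rw [Real.rpow_neg ht0.le, ← one_div]
        exact one_div_le_one_div_of_le (by positivity) h1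
      have h3 := pairProb_le_one (θ := θ) hy hz
      have h4 := pairProb_nonneg (θ := θ) hw hz
      nlinarith
    · refine hred (8 * 6 ^ θ) (by linarith) (hG.trans ?_)
      have hzt : t / 2 ≤ z := by linarith
      calc (w ^ θ - y ^ θ) / (w ^ θ + z ^ θ) ≤ w ^ θ / z ^ θ := by
            have : 0 < z ^ θ := Real.rpow_pos_of_pos (by linarith) _
            gcongr
            · linarith
            · linarith
        _ = (w / z) ^ θ := (Real.div_rpow hw hz θ).symm
        _ ≤ (6 / t) ^ θ := by
            refine Real.rpow_le_rpow (by positivity) ?_ hθ0.le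
            rw [div_le_div_iff₀ (by linarith) ht0]
            nlinarith
        _ = 6 ^ θ * t ^ (-θ) := by
            rw [Real.div_rpow (by norm_num) ht0.le, Real.rpow_neg ht0.le, div_eq_mul_inv]
        _ ≤ 6 ^ θ * t ^ (-α) := by
            gcongr
            linarith
        _ ≤ 8 * 6 ^ θ * (x * t ^ (-α)) := by
            have : 0 < 6 ^ θ * t ^ (-α) := by positivity
            nlinarith
  · refine hred (15 * θ) (by linarith) (hG.trans ?_)
    have hA : w ^ (θ - α) * (t / 3) ^ α ≤ w ^ θ + z ^ θ := by
      refine rpow_mul_rpow_le_of_le hw0 (by positivity) (by linarith) hαθ (by linarith) ?_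
      rcases le_total w z with hwz | hwz
      · have := Real.rpow_le_rpow (z := θ) (by positivity) (show t / 3 ≤ z by linarith) hθ0.le
        linarith
      · have := Real.rpow_le_rpow (z := θ) (by positivity) (show t / 3 ≤ w by linarith) hθ0.le
        linarith
    have h3 : (3 : ℝ) ^ α ≤ 9 := by
      calc (3 : ℝ) ^ α ≤ 3 ^ (2 : ℝ) := Real.rpow_le_rpow_of_exponent_le (by norm_num) hα2
        _ = 9 := by norm_num
    have hwα : w ^ (α - 1) ≤ 5 / 4 * x := by
      calc w ^ (α - 1) ≤ (5 / 4 * x) ^ (α - 1) :=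
            Real.rpow_le_rpow hw (by linarith) (by linarith)
        _ ≤ (5 / 4 * x) ^ (1 : ℝ) :=
            Real.rpow_le_rpow_of_exponent_le (by linarith) (by linarith)
        _ = 5 / 4 * x := Real.rpow_one _
    calc (w ^ θ - y ^ θ) / (w ^ θ + z ^ θ)
        ≤ (θ * w ^ (θ - 1) * (5 / 4)) / (w ^ (θ - α) * (t / 3) ^ α) := by
          have h1 := rpow_sub_rpow_le hθ.le hy hw0
          have h2 : θ * w ^ (θ - 1) * (w - y) ≤ θ * w ^ (θ - 1) * (5 / 4) := by
            gcongr; linarith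
          gcongr
          linarith
      _ = 5 / 4 * θ * w ^ (α - 1) * 3 ^ α * t ^ (-α) := by
          rw [Real.div_rpow ht0.le (by norm_num), Real.rpow_neg ht0.le,
            show θ - 1 = (θ - α) + (α - 1) by ring, Real.rpow_add hw0]
          field_simp
      _ ≤ 5 / 4 * θ * (5 / 4 * x) * 9 * t ^ (-α) := by gcongr
      _ ≤ 15 * θ * (x * t ^ (-α)) := by
          have : 0 < θ * (x * t ^ (-α)) := by positivity
          nlinarith

/-! ### The winner in expectation -/

lemma sum_sum_pairProb_self {m : ℕ} {θ : ℝ} {c : Fin m → ℝ} (hc : ∀ j, 0 ≤ c j)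
    (N : Finset (Fin m)) :
    ∑ a ∈ N, ∑ b ∈ N, pairProb θ (c a) (c b) = ∑ _a ∈ N, ∑ _b ∈ N, (1 / 2 : ℝ) := by
  have h1 : ∑ a ∈ N, ∑ b ∈ N, pairProb θ (c a) (c b) + ∑ a ∈ N, ∑ b ∈ N, pairProb θ (c a) (c b) =
      ∑ _a ∈ N, ∑ _b ∈ N, (1 : ℝ) := by
    nth_rw 2 [Finset.sum_comm]
    simp_rw [← Finset.sum_add_distrib, pairProb_add_swap (hc _) (hc _)]
  have h2 : ∑ _a ∈ N, ∑ _b ∈ N, (1 / 2 : ℝ) + ∑ _a ∈ N, ∑ _b ∈ N, (1 / 2 : ℝ) =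
      ∑ _a ∈ N, ∑ _b ∈ N, (1 : ℝ) := by
    simp_rw [← Finset.sum_add_distrib]; norm_num
  linarith

/-- For a single voter, the comparison of a candidate at distance `y` with the average of a set
`N` of candidates. The comparisons within `N` contribute `1 / 2` on average. -/
lemma sum_share_sub {m : ℕ} {θ : ℝ} {c : Fin m → ℝ} (hc : ∀ j, 0 ≤ c j) (y : ℝ)
    (N : Finset (Fin m)) :
    ∑ a ∈ N, (share θ c y - share θ c (c a)) =
      ∑ a ∈ N, (∑ b ∈ N, (pairProb θ y (c b) - 1 / 2) +
        ∑ b ∈ Nᶜ, (pairProb θ y (c b) - pairProb θ (c a) (c b))) := by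
  have hs : ∀ x, share θ c x = ∑ b ∈ N, pairProb θ x (c b) + ∑ b ∈ Nᶜ, pairProb θ x (c b) :=
    fun x => (Finset.sum_add_sum_compl N _).symm
  have h := sum_sum_pairProb_self (θ := θ) hc N
  simp_rw [hs, Finset.sum_sub_distrib, Finset.sum_add_distrib, Finset.sum_sub_distrib]
  rw [h]; ring

/-- A power mean inequality. -/
lemma sum_rpow_neg_le {ι : Type*} (F : Finset ι) {t : ι → ℝ} (ht : ∀ f ∈ F, 0 < t f) {m : ℕ}
    (hm : 1 ≤ m) (hF : F.card ≤ m) {θ e : ℝ} (he0 : 0 ≤ e) (he1 : e ≤ 1) :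
    ∑ f ∈ F, t f ^ (-(θ * (1 - e))) ≤ (m : ℝ) ^ e * (1 + ∑ f ∈ F, t f ^ (-θ)) := by
  have hm0 : (0 : ℝ) < m := by exact_mod_cast hm
  have hterm : ∀ f ∈ F, t f ^ (-(θ * (1 - e))) ≤ (m : ℝ) ^ e * (1 / m + t f ^ (-θ)) := by
    intro f hf
    have hv : 0 < t f ^ (-θ) := Real.rpow_pos_of_pos (ht f hf) _
    have h1 : t f ^ (-(θ * (1 - e))) = (m : ℝ) ^ e / m * (m * t f ^ (-θ)) ^ (1 - e) := by
      rw [Real.mul_rpow hm0.le hv.le, ← Real.rpow_mul (ht f hf).le, neg_mul, ← mul_assoc,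
        div_mul_eq_mul_div, ← Real.rpow_add hm0, add_sub_cancel, Real.rpow_one, div_self hm0.ne',
        one_mul]
    have h2 : (m * t f ^ (-θ)) ^ (1 - e) ≤ 1 + m * t f ^ (-θ) := by
      rcases le_total (m * t f ^ (-θ)) 1 with h | h
      · have := Real.rpow_le_one (by positivity) h (show 0 ≤ 1 - e by linarith)
        have : 0 < m * t f ^ (-θ) := by positivity
        linarith
      · have := Real.rpow_le_self_of_one_le h (show 1 - e ≤ 1 by linarith)
        linarith
    rw [h1]
    calc _ ≤ (m : ℝ) ^ e / m * (1 + m * t f ^ (-θ)) := by gcongr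
      _ = _ := by field_simp
  calc _ ≤ ∑ f ∈ F, (m : ℝ) ^ e * (1 / m + t f ^ (-θ)) := Finset.sum_le_sum hterm
    _ = (m : ℝ) ^ e * (F.card / m + ∑ f ∈ F, t f ^ (-θ)) := by
        rw [← Finset.mul_sum, Finset.sum_add_distrib]; simp [div_eq_mul_inv]
    _ ≤ _ := by
        gcongr
        rw [div_le_one hm0]; exact_mod_cast hF

/-- The normalized form of the upper bound: candidate `k` is at distance `1` from the winner `j`,
`u i c` is the distance between voter `i` and candidate `c`, and `t c` is that between the
candidates `c` and `k`. -/
lemma exists_card_le_mul_sum {θ : ℝ} (hθ : 1 < θ) : ∃ K : ℝ, 0 < K ∧ ∀ (n m : ℕ)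
    (u : Fin n → Fin m → ℝ) (t : Fin m → ℝ) (j k : Fin m), (∀ i c, 0 ≤ u i c) → t k = 0 →
    (∀ i, 1 ≤ u i j + u i k) → (∀ i c, t c ≤ u i c + u i k) → (∀ i c, u i c ≤ u i k + t c) →
    (∀ i c, u i k ≤ u i c + t c) → (∀ i c, u i c ≤ u i j + t c + 1) →
    (∀ c, ∑ i, share θ (u i) (u i c) ≤ ∑ i, share θ (u i) (u i j)) →
    (n : ℝ) ≤ K * (m : ℝ) ^ max (1 - 2 / θ) 0 * ∑ i, u i k := by
  obtain ⟨c₁, hc₁, hloss⟩ := exists_far_loss hθ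
  obtain ⟨C₂, hC₂, hgain⟩ := exists_far_gain hθ
  have hθ0 : 0 < θ := by linarith
  set κ : ℝ := min (1 / 5) c₁
  have hκ0 : 0 < κ := lt_min (by norm_num) hc₁
  have hκ1 : κ ≤ 1 / 5 := min_le_left _ _
  have hκ2 : κ ≤ c₁ := min_le_right _ _
  refine ⟨(8 * κ + 4 + C₂) / κ, by positivity, ?_⟩
  intro n m u t j k hu htk hjk h1 h2 h3 h4 hwin
  set e : ℝ := max (1 - 2 / θ) 0
  have he0 : 0 ≤ e := le_max_right _ _
  have h2θ : 2 / θ * θ = 2 := by field_simp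
  have he2 : e ≤ 1 - 1 / θ := by
    have : 1 / θ ≤ 1 := (div_le_one hθ0).2 hθ.le
    refine max_le ?_ (by linarith)
    have : 1 / θ ≤ 2 / θ := by gcongr; norm_num
    linarith
  have he1 : e ≤ 1 := by
    have : 0 < 1 / θ := by positivity
    linarith
  set α : ℝ := θ * (1 - e) with hα
  have hα1 : 1 ≤ α := by
    have : θ * (1 / θ) = 1 := by field_simp
    nlinarith
  have hα2 : α ≤ 2 := by
    have : 1 - 2 / θ ≤ e := le_max_left _ _
    nlinarith
  have hαθ : α ≤ θ := by nlinarith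
  have hm : 1 ≤ m := Nat.one_le_of_lt j.isLt
  set M : ℝ := (m : ℝ) ^ e
  have hM1 : 1 ≤ M := Real.one_le_rpow (by exact_mod_cast hm) he0
  set N : Finset (Fin m) := Finset.univ.filter fun c => t c ≤ 1 / 4 with hN
  have hNmem : ∀ c, c ∈ N ↔ t c ≤ 1 / 4 := fun c => by simp [hN]
  have hFmem : ∀ c, c ∈ Nᶜ ↔ 1 / 4 < t c := fun c => by simp [hN]
  set q : ℝ := (N.card : ℝ) with hq
  have hkN : k ∈ N := (hNmem k).2 (by rw [htk]; norm_num)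
  have hq1 : 1 ≤ q := Nat.one_le_cast.2 (Finset.card_pos.2 ⟨k, hkN⟩)
  set T : ℝ := ∑ f ∈ Nᶜ, t f ^ (-θ) with hT
  set Tα : ℝ := ∑ f ∈ Nᶜ, t f ^ (-α) with hTα
  have htF : ∀ f ∈ Nᶜ, 0 < t f := fun f hf => by linarith [(hFmem f).1 hf]
  have hT0 : 0 ≤ T := Finset.sum_nonneg fun f hf => Real.rpow_nonneg (htF f hf).le _
  have hTα0 : 0 ≤ Tα := Finset.sum_nonneg fun f hf => Real.rpow_nonneg (htF f hf).le _
  have hpm : Tα ≤ M * (1 + T) := sum_rpow_neg_le Nᶜ htF hm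
    ((Finset.card_le_univ _).trans_eq (Fintype.card_fin m)) he0 he1
  set B : ℝ := 8 * (κ * (q + T)) + 4 * q + C₂ * Tα with hB
  -- For voters close to `k` the first summand is the loss of `j`. For all other voters it is
  -- compensated by a part of the second one.
  have hvoter : ∀ i, ∀ c ∈ N, ∑ b ∈ N, (pairProb θ (u i j) (u i b) - 1 / 2) +
      ∑ b ∈ Nᶜ, (pairProb θ (u i j) (u i b) - pairProb θ (u i c) (u i b)) ≤
      -(κ * (q + T)) + u i k * B := by
    intro i c hc
    have hcN := (hNmem c).1 hc
    have hB0 : 0 ≤ B := by positivity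
    rcases lt_or_ge (u i k) (1 / 8) with hx | hx
    · have hy : 7 / 8 ≤ u i j := by linarith [hjk i]
      have hnear : ∑ b ∈ N, (pairProb θ (u i j) (u i b) - 1 / 2) ≤ ∑ b ∈ N, (-κ) := by
        refine Finset.sum_le_sum fun b hb => ?_
        have hb' : u i b ≤ 3 / 8 := by linarith [h2 i b, (hNmem b).1 hb]
        have hle := pairProb_le_div hθ.le (hu i b) (by linarith) (show 0 < u i j by linarith)
        have : u i b / (u i j + u i b) ≤ 3 / 10 := by
          rw [div_le_iff₀ (by linarith [hu i b])]; linarith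
        linarith
      have hfar : ∑ b ∈ Nᶜ, (pairProb θ (u i j) (u i b) - pairProb θ (u i c) (u i b)) ≤
          ∑ b ∈ Nᶜ, -(κ * t b ^ (-θ)) := by
        refine Finset.sum_le_sum fun b hb => ?_
        have hb' := (hFmem b).1 hb
        refine (hloss _ _ _ (t b) hy (hu i c) (by linarith [h2 i c]) hb' (by linarith [h1 i b])
          (by linarith [h2 i b])).trans ?_
        have := Real.rpow_pos_of_pos (htF b hb) (-θ)
        nlinarith
      rw [Finset.sum_const, nsmul_eq_mul] at hnear
      rw [Finset.sum_neg_distrib, ← Finset.mul_sum] at hfar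
      have : 0 ≤ u i k * B := mul_nonneg (hu i k) hB0
      nlinarith
    · have hnear : ∑ b ∈ N, (pairProb θ (u i j) (u i b) - 1 / 2) ≤ ∑ b ∈ N, (1 / 2 : ℝ) :=
        Finset.sum_le_sum fun b _ => by linarith [pairProb_le_one (θ := θ) (hu i j) (hu i b)]
      have hfar : ∑ b ∈ Nᶜ, (pairProb θ (u i j) (u i b) - pairProb θ (u i c) (u i b)) ≤
          ∑ b ∈ Nᶜ, C₂ * (u i k * t b ^ (-α)) :=
        Finset.sum_le_sum fun b hb => hgain α _ _ _ (t b) (u i k) (t c) hα1 hα2 hαθ hx (hu i j)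
          (hu i c) (hu i b) hcN (h2 i c) (h3 i c) (h4 i c) ((hFmem b).1 hb) (h1 i b)
      rw [Finset.sum_const, nsmul_eq_mul] at hnear
      rw [← Finset.mul_sum, ← Finset.mul_sum] at hfar
      have e1 : κ * (q + T) ≤ 8 * u i k * (κ * (q + T)) := by
        have : 0 ≤ κ * (q + T) := by positivity
        nlinarith
      have e2 : q * (1 / 2) ≤ 4 * u i k * q := by nlinarith
      have e3 : u i k * B = 8 * u i k * (κ * (q + T)) + 4 * u i k * q + C₂ * (u i k * Tα) := by
        rw [hB]; ring
      linarith
  have hsum : 0 ≤ ∑ i, (q * (-(κ * (q + T)) + u i k * B)) := by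
    calc (0 : ℝ) ≤ ∑ c ∈ N, (∑ i, share θ (u i) (u i j) - ∑ i, share θ (u i) (u i c)) :=
          Finset.sum_nonneg fun c _ => sub_nonneg.2 (hwin c)
      _ = ∑ i, ∑ c ∈ N, (share θ (u i) (u i j) - share θ (u i) (u i c)) := by
          simp_rw [← Finset.sum_sub_distrib]; rw [Finset.sum_comm]
      _ ≤ ∑ i, ∑ c ∈ N, (-(κ * (q + T)) + u i k * B) := by
          refine Finset.sum_le_sum fun i _ => ?_
          rw [sum_share_sub (hu i)]
          exact Finset.sum_le_sum (hvoter i)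
      _ = _ := by simp only [Finset.sum_const, nsmul_eq_mul, hq]
  rw [← Finset.mul_sum, Finset.sum_add_distrib, ← Finset.sum_mul] at hsum
  simp only [Finset.sum_const, Finset.card_univ, Fintype.card_fin, nsmul_eq_mul] at hsum
  have hsum' := nonneg_of_mul_nonneg_right hsum (by linarith)
  have hX : 0 ≤ ∑ i, u i k := Finset.sum_nonneg fun i _ => hu i k
  have hBle : B ≤ (8 * κ + 4 + C₂) * M * (q + T) := by
    have f0 : q + T ≤ M * (q + T) := le_mul_of_one_le_left (by linarith) hM1
    have f1 : 8 * κ * (q + T) ≤ 8 * κ * (M * (q + T)) := by gcongr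
    have f2 : q ≤ M * (q + T) := by linarith
    have f3 : Tα ≤ M * (q + T) := by
      refine hpm.trans ?_
      gcongr
    have f4 : C₂ * Tα ≤ C₂ * (M * (q + T)) := by gcongr
    rw [hB]; linarith
  have hfin : n * κ * (q + T) ≤ (∑ i, u i k) * ((8 * κ + 4 + C₂) * M) * (q + T) := by
    have := mul_le_mul_of_nonneg_left hBle hX
    linarith
  have hfin' := le_of_mul_le_mul_right hfin (by linarith)
  rw [div_mul_eq_mul_div, div_mul_eq_mul_div, le_div_iff₀ hκ0]
  linarith

/-- A candidate of maximal expected Borda score has social cost at most of order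
`m ^ max (1 - 2 / θ) 0` times that of any other candidate. -/
theorem exists_socialCost_le {θ : ℝ} (hθ : 1 < θ) : ∃ K : ℝ, 0 < K ∧ ∀ (n m : ℕ)
    (D : PseudoMetricSpace (Fin n ⊕ Fin m)) (j k : Fin m),
    (∀ c, expectedBorda θ D c ≤ expectedBorda θ D j) →
    socialCost D j ≤ K * (m : ℝ) ^ max (1 - 2 / θ) 0 * socialCost D k := by
  obtain ⟨K, hK, h⟩ := exists_card_le_mul_sum hθ
  refine ⟨1 + K, by linarith, fun n m D j k hwin => ?_⟩
  have hm : (1 : ℝ) ≤ m := by exact_mod_cast Nat.one_le_of_lt j.isLt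
  set M : ℝ := (m : ℝ) ^ max (1 - 2 / θ) 0
  have hM1 : 1 ≤ M := Real.one_le_rpow hm (le_max_right _ _)
  have hk := socialCost_nonneg D k
  let _ := D
  set δ : ℝ := dist (Sum.inr j : Fin n ⊕ Fin m) (Sum.inr k) with hδ
  have htri : socialCost D j ≤ socialCost D k + n * δ := by
    calc socialCost D j ≤ ∑ i, (cost D i k + δ) := Finset.sum_le_sum fun i _ => by
          rw [hδ, dist_comm (Sum.inr j)]; exact dist_triangle _ _ _
      _ = _ := by rw [Finset.sum_add_distrib]; simp [socialCost]
  have hδ0 : 0 ≤ δ := dist_nonneg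
  rcases hδ0.eq_or_lt with h0 | h0
  · rw [← h0, mul_zero, add_zero] at htri
    refine htri.trans (le_mul_of_one_le_left hk ?_)
    nlinarith
  have hscale : ∀ i a b, pairProb θ (cost D i a / δ) (cost D i b / δ) =
      pairProb θ (cost D i a) (cost D i b) :=
    fun i a b => pairProb_scale (cost_nonneg D i a) (cost_nonneg D i b) h0
  have hn := h n m (fun i c => cost D i c / δ)
    (fun c => dist (Sum.inr c : Fin n ⊕ Fin m) (Sum.inr k) / δ) j k
    (fun i c => div_nonneg (cost_nonneg D i c) h0.le) (by simp)
    (fun i => by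
      rw [← add_div, le_div_iff₀ h0, one_mul]; exact dist_triangle_left _ _ _)
    (fun i c => by
      rw [← add_div]; gcongr; exact dist_triangle_left _ _ _)
    (fun i c => by
      rw [← add_div, dist_comm (Sum.inr c)]; gcongr; exact dist_triangle _ _ _)
    (fun i c => by
      rw [← add_div]; gcongr; exact dist_triangle _ _ _)
    (fun i c => by
      rw [← add_div, ← div_self h0.ne', ← add_div]
      gcongr
      calc cost D i c ≤ cost D i j + dist (Sum.inr j : Fin n ⊕ Fin m) (Sum.inr c) :=
            dist_triangle _ _ _
        _ ≤ cost D i j + (δ + dist (Sum.inr k : Fin n ⊕ Fin m) (Sum.inr c)) := by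
            gcongr; exact dist_triangle _ _ _
        _ = _ := by rw [dist_comm (Sum.inr k)]; ring)
    (fun c => by
      have := hwin c
      simp only [expectedBorda, share] at this
      simpa only [share, hscale] using this)
  rw [← Finset.sum_div, mul_div_assoc', le_div_iff₀ h0] at hn
  have : socialCost D k ≤ M * socialCost D k := le_mul_of_one_le_left hk hM1
  change n * δ ≤ K * M * socialCost D k at hn
  linarith

/-! ### The limit distortion -/

/-- Candidate `j` has maximal expected Borda score, and all other candidates of maximal expected
score are at the same location as `j`. -/
def IsStrictWinner {n m : ℕ} (θ : ℝ) (D : PseudoMetricSpace (Fin n ⊕ Fin m)) (j : Fin m) : Prop :=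
  ∀ c, expectedBorda θ D c < expectedBorda θ D j ∨ D.dist (Sum.inr c) (Sum.inr j) = 0

/-- The ratios between the social cost of a strict winner in expectation and the positive social
cost of another candidate, for any number of voters. -/
def winnerRatios (θ : ℝ) (m : ℕ) : Set ℝ :=
  {ρ | ∃ (n : ℕ) (D : PseudoMetricSpace (Fin n ⊕ Fin m)) (j k : Fin m),
    IsStrictWinner θ D j ∧ 0 < socialCost D k ∧ ρ = socialCost D j / socialCost D k}

/-- The limit of the metric distortion as the number of voters tends to infinity. -/
noncomputable def limitDistortion (θ : ℝ) (m : ℕ) : ℝ := sSup (winnerRatios θ m)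

section Basic

variable {n m : ℕ} {θ : ℝ} (D : PseudoMetricSpace (Fin n ⊕ Fin m))

lemma cost_eq_of_dist_eq_zero {c j : Fin m} (h : D.dist (Sum.inr c) (Sum.inr j) = 0) (i : Fin n) :
    cost D i c = cost D i j := by
  let _ := D
  have h1 : cost D i c ≤ cost D i j + dist (Sum.inr j : Fin n ⊕ Fin m) (Sum.inr c) :=
    dist_triangle _ _ _
  have h2 : cost D i j ≤ cost D i c + dist (Sum.inr c : Fin n ⊕ Fin m) (Sum.inr j) :=
    dist_triangle _ _ _
  rw [dist_comm] at h1
  have h' : dist (Sum.inr c : Fin n ⊕ Fin m) (Sum.inr j) = 0 := h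
  linarith

lemma socialCost_eq_of_dist_eq_zero {c j : Fin m} (h : D.dist (Sum.inr c) (Sum.inr j) = 0) :
    socialCost D c = socialCost D j :=
  Finset.sum_congr rfl fun i _ => cost_eq_of_dist_eq_zero D h i

lemma expectedBorda_eq_of_dist_eq_zero {c j : Fin m} (h : D.dist (Sum.inr c) (Sum.inr j) = 0) :
    expectedBorda θ D c = expectedBorda θ D j :=
  Finset.sum_congr rfl fun i _ => by rw [cost_eq_of_dist_eq_zero D h i]

lemma card_mul_dist_le (j k : Fin m) :
    n * D.dist (Sum.inr j) (Sum.inr k) ≤ socialCost D j + socialCost D k := by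
  let _ := D
  calc n * D.dist (Sum.inr j) (Sum.inr k) =
        ∑ _i : Fin n, dist (Sum.inr j : Fin n ⊕ Fin m) (Sum.inr k) := by simp
    _ ≤ ∑ i, (cost D i j + cost D i k) := Finset.sum_le_sum fun i _ => dist_triangle_left _ _ _
    _ = _ := Finset.sum_add_distrib

lemma socialCost_le_add (j k : Fin m) :
    socialCost D j ≤ socialCost D k + n * D.dist (Sum.inr j) (Sum.inr k) := by
  let _ := D
  calc socialCost D j ≤ ∑ i, (cost D i k + dist (Sum.inr j : Fin n ⊕ Fin m) (Sum.inr k)) :=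
        Finset.sum_le_sum fun i _ => by
          rw [dist_comm (Sum.inr j)]; exact dist_triangle _ _ _
    _ = _ := by rw [Finset.sum_add_distrib]; simp [socialCost]

end Basic

lemma winnerRatios_bounded {θ : ℝ} (hθ : 1 < θ) :
    ∃ K : ℝ, 0 < K ∧ ∀ m, ∀ ρ ∈ winnerRatios θ m, ρ ≤ K * (m : ℝ) ^ max (1 - 2 / θ) 0 := by
  obtain ⟨K, hK, h⟩ := exists_socialCost_le hθ
  refine ⟨K, hK, ?_⟩
  rintro m ρ ⟨n, D, j, k, hj, hk, rfl⟩
  rw [div_le_iff₀ hk]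
  refine h n m D j k fun c => ?_
  rcases hj c with hc | hc
  · exact hc.le
  · exact (expectedBorda_eq_of_dist_eq_zero D hc).le

lemma bddAbove_winnerRatios {θ : ℝ} (hθ : 1 < θ) (m : ℕ) : BddAbove (winnerRatios θ m) := by
  obtain ⟨K, _, h⟩ := winnerRatios_bounded hθ
  exact ⟨_, fun ρ hρ => h m ρ hρ⟩

lemma limitDistortion_nonneg (θ : ℝ) (m : ℕ) : 0 ≤ limitDistortion θ m := by
  refine Real.sSup_nonneg ?_
  rintro ρ ⟨n, D, j, k, -, -, rfl⟩
  exact div_nonneg (socialCost_nonneg D j) (socialCost_nonneg D k)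

/-- If all candidates are at the same location, away from a single voter, the ratio is `1`. -/
lemma one_mem_winnerRatios (θ : ℝ) {m : ℕ} (hm : 1 ≤ m) : 1 ∈ winnerRatios θ m := by
  let D : PseudoMetricSpace (Fin 1 ⊕ Fin m) :=
    PseudoMetricSpace.induced (Sum.elim (fun _ => (0 : ℝ)) fun _ => 1) inferInstance
  have hD : ∀ x, socialCost D x = 1 := by
    intro x
    have : cost D 0 x = |(0 : ℝ) - 1| := rfl
    simp [socialCost, this]
  refine ⟨1, D, ⟨0, hm⟩, ⟨0, hm⟩, fun c => Or.inr ?_, ?_, ?_⟩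
  · change |(1 : ℝ) - 1| = 0
    simp
  · rw [hD]; norm_num
  · rw [hD]; norm_num

/-! ### Candidates that almost win in expectation -/

lemma share_add_one_le {m : ℕ} {θ : ℝ} (hθ : 0 < θ) {c : Fin m → ℝ} (hc : ∀ j, 0 ≤ c j)
    {a b : Fin m} (ha : c a = 0) (hb : 0 < c b) : share θ c (c b) + 1 ≤ share θ c (c a) := by
  have hab : a ≠ b := by rintro rfl; exact hb.ne' ha
  have h : ∑ x ∈ {a, b}, (pairProb θ (c a) (c x) - pairProb θ (c b) (c x)) ≤
      ∑ x, (pairProb θ (c a) (c x) - pairProb θ (c b) (c x)) :=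
    Finset.sum_le_sum_of_subset_of_nonneg (Finset.subset_univ _) fun x _ _ =>
      sub_nonneg.2 (pairProb_anti_left hθ (hc a) (by rw [ha]; exact hc b) (hc x))
  rw [Finset.sum_pair hab, Finset.sum_sub_distrib, pairProb_self (hc a), pairProb_self (hc b),
    ha, pairProb_zero_left hθ hb, pairProb_zero_right hθ hb] at h
  unfold share
  rw [ha]
  linarith

/-- A candidate `j` whose expected Borda score is maximal up to `δ * n` becomes a strict winner if
about `δ * n` voters are added at its location. This hardly affects the ratio of the social
costs. -/
lemma socialCost_le_of_almost_winner {n m : ℕ} {θ : ℝ} (hθ : 1 < θ)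
    (D : PseudoMetricSpace (Fin n ⊕ Fin m)) {j k : Fin m} {R δ : ℝ} (hδ : 0 < δ)
    (hδn : 1 ≤ δ * n) (hk : 0 < socialCost D k) (hR : socialCost D j ≤ R * socialCost D k)
    (hj : ∀ c, expectedBorda θ D c ≤ expectedBorda θ D j + δ * n) :
    socialCost D j ≤ limitDistortion θ m * (1 + 2 * δ * (1 + R)) * socialCost D k := by
  have hθ0 : 0 < θ := by linarith
  let e : ℕ := ⌊δ * n⌋₊ + 1
  have he1 : δ * n < e := by
    have := Nat.lt_floor_add_one (δ * n)
    simpa [e] using this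
  have he2 : (e : ℝ) ≤ 2 * (δ * n) := by
    have := Nat.floor_le (show 0 ≤ δ * n by linarith)
    have h' : (e : ℝ) = ⌊δ * n⌋₊ + 1 := by simp [e]
    linarith
  let φ : Fin (n + e) → Fin n ⊕ Fin m := Fin.append Sum.inl fun _ => Sum.inr j
  let D' : PseudoMetricSpace (Fin (n + e) ⊕ Fin m) :=
    PseudoMetricSpace.induced (Sum.elim φ Sum.inr) D
  let d : Fin m → ℝ := fun c => D.dist (Sum.inr j) (Sum.inr c)
  have hd0 : ∀ c, 0 ≤ d c := fun c => by let _ := D; exact dist_nonneg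
  have hdj : d j = 0 := D.dist_self _
  have hcost : ∀ (i : Fin (n + e)) c, cost D' i c = D.dist (φ i) (Sum.inr c) := fun _ _ => rfl
  have hcost1 : ∀ i : Fin n, cost D' (Fin.castAdd e i) = cost D i := fun i => by
    funext c; rw [hcost]; simp only [φ, Fin.append_left]; rfl
  have hcost2 : ∀ i : Fin e, cost D' (Fin.natAdd n i) = d := fun i => by
    funext c; rw [hcost]; simp only [φ, Fin.append_right, d]
  have hSC : ∀ c, socialCost D' c = socialCost D c + e * d c := by
    intro c
    unfold socialCost
    rw [Fin.sum_univ_add]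
    simp only [hcost1, hcost2]
    simp
  have hEB : ∀ c, expectedBorda θ D' c = expectedBorda θ D c + e * share θ d (d c) := by
    intro c
    unfold expectedBorda
    rw [Fin.sum_univ_add]
    simp only [hcost1, hcost2]
    simp
  have hwin : IsStrictWinner θ D' j := by
    intro c
    by_cases hc : d c = 0
    · right
      change D.dist (Sum.inr c) (Sum.inr j) = 0
      rw [D.dist_comm]; exact hc
    · left
      have h1 := share_add_one_le hθ0 hd0 hdj (lt_of_le_of_ne (hd0 c) (Ne.symm hc))
      rw [hEB, hEB]
      have h2 : (e : ℝ) * (share θ d (d c) + 1) ≤ e * share θ d (d j) := by gcongr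
      linarith [hj c]
  have hed : 0 ≤ e * d k := mul_nonneg (Nat.cast_nonneg _) (hd0 k)
  have hk' : 0 < socialCost D' k := by rw [hSC]; linarith
  have hV := le_csSup (bddAbove_winnerRatios hθ m) ⟨n + e, D', j, k, hwin, hk', rfl⟩
  rw [div_le_iff₀ hk', hSC, hSC, hdj, mul_zero, add_zero] at hV
  have hdk : e * d k ≤ 2 * δ * ((1 + R) * socialCost D k) := by
    calc (e : ℝ) * d k ≤ 2 * (δ * n) * d k := mul_le_mul_of_nonneg_right he2 (hd0 k)
      _ = 2 * δ * (n * d k) := by ring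
      _ ≤ 2 * δ * (socialCost D j + socialCost D k) := by
          gcongr; exact card_mul_dist_le D j k
      _ ≤ 2 * δ * ((1 + R) * socialCost D k) := by
          gcongr; linarith
  refine hV.trans ?_
  rw [mul_assoc]
  exact mul_le_mul_of_nonneg_left (by linarith) (limitDistortion_nonneg θ m)

/-! ### The upper bound for finitely many voters -/

lemma pairProb_le_two_mul_div {θ x y d : ℝ} (hθ : 1 ≤ θ) (hx : 0 ≤ x) (hy : 0 ≤ y) (hd : 0 < d)
    (hdxy : d ≤ y + x) : pairProb θ y x ≤ 2 * x / d := by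
  rcases le_or_gt (d / 2) x with h | h
  · refine (pairProb_le_one hy hx).trans ?_
    rw [le_div_iff₀ hd]; linarith
  · refine (pairProb_le_div hθ hx (by linarith) (by linarith)).trans ?_
    rw [div_le_div_iff₀ (by linarith) hd]
    nlinarith

/-- A candidate `j` that is much more expensive than another candidate is elected with a
probability so small that its contribution to the expected social cost vanishes in the limit,
uniformly in `socialCost D j`. -/
lemma winProb_mul_socialCost_le {n m : ℕ} {θ : ℝ} (hθ : 1 < θ)
    {D : PseudoMetricSpace (Fin n ⊕ Fin m)} {f : VotingRule n m} (hf : IsBordaRule f) (hn : 0 < n)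
    {j k : Fin m} (hR : (1 + 4 * m) * socialCost D k ≤ socialCost D j) :
    winProb θ D f j * socialCost D j ≤ 16 * m ^ 2 / n * socialCost D k := by
  have hm : (0 : ℝ) < m := by exact_mod_cast Nat.lt_of_le_of_lt (Nat.zero_le _) j.isLt
  have hn' : (0 : ℝ) < n := by exact_mod_cast hn
  have hk := socialCost_nonneg D k
  set d : ℝ := D.dist (Sum.inr j) (Sum.inr k) with hd
  have hd0 : 0 ≤ d := by let _ := D; exact dist_nonneg
  rcases hd0.eq_or_lt with h0 | h0
  · have he := socialCost_eq_of_dist_eq_zero D (hd.symm.trans h0.symm)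
    have : socialCost D k = 0 := by nlinarith
    rw [he, this, mul_zero, mul_zero]
  have hjk : j ≠ k := by rintro rfl; exact h0.ne' (hd.trans (D.dist_self _))
  have htri : socialCost D j ≤ socialCost D k + n * d := socialCost_le_add D j k
  have hsum : ∑ i, pairProb θ (cost D i j) (cost D i k) ≤ 2 * socialCost D k / d := by
    rw [socialCost, Finset.mul_sum, Finset.sum_div]
    refine Finset.sum_le_sum fun i _ => pairProb_le_two_mul_div hθ.le (cost_nonneg D i k)
      (cost_nonneg D i j) h0 ?_
    let _ := D
    exact dist_triangle_left _ _ _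
  have hfew : ∑ i, pairProb θ (cost D i j) (cost D i k) ≤ n / (2 * m) := by
    refine hsum.trans ?_
    rw [div_le_div_iff₀ h0 (by positivity)]
    linarith
  have hw := winProb_le_of_few_votes (by linarith) hf hn hjk hfew
  have hSCj : socialCost D j ≤ 2 * (n * d) := by
    have : 0 ≤ 4 * m * socialCost D k := by positivity
    have : (1 : ℝ) ≤ m := by exact_mod_cast Nat.one_le_of_lt j.isLt
    nlinarith
  calc winProb θ D f j * socialCost D j
      ≤ (2 * socialCost D k / d) / (n / (2 * m)) ^ 2 * (2 * (n * d)) := by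
        refine mul_le_mul (hw.trans ?_) hSCj (socialCost_nonneg D j) (by positivity)
        gcongr
    _ = 16 * m ^ 2 / n * socialCost D k := by
        field_simp; ring

lemma expectedCost_le {n m : ℕ} {θ : ℝ} (hθ : 1 < θ) (D : PseudoMetricSpace (Fin n ⊕ Fin m))
    {f : VotingRule n m} (hf : IsBordaRule f) {δ : ℝ} (hδ : 0 < δ) (hδn : 1 ≤ δ * n)
    (k : Fin m) :
    expectedCost θ D f ≤ (limitDistortion θ m * (1 + 2 * δ * (1 + (1 + 4 * m))) +
      m * (16 * m ^ 2 + m ^ 2 * (1 + 4 * m) / δ ^ 2) / n) * socialCost D k := by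
  have hn0 : n ≠ 0 := by rintro rfl; norm_num at hδn
  have hn : 0 < n := Nat.pos_of_ne_zero hn0
  have hn' : (0 : ℝ) < n := by exact_mod_cast hn
  have hk := socialCost_nonneg D k
  set R : ℝ := 1 + 4 * m with hRdef
  have hR0 : 0 < R := by positivity
  set A : ℝ := limitDistortion θ m * (1 + 2 * δ * (1 + R))
  have hA : 0 ≤ A := mul_nonneg (limitDistortion_nonneg θ m) (by positivity)
  have hj : ∀ j, winProb θ D f j * socialCost D j ≤ winProb θ D f j * (A * socialCost D k) +
      (16 * m ^ 2 + m ^ 2 * R / δ ^ 2) / n * socialCost D k := by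
    intro j
    have hw0 : 0 ≤ winProb θ D f j := winProb_nonneg j
    have hpos : 0 ≤ winProb θ D f j * (A * socialCost D k) := by positivity
    rw [add_div, add_mul]
    have hpos1 : 0 ≤ 16 * m ^ 2 / n * socialCost D k := by positivity
    have hpos2 : 0 ≤ m ^ 2 * R / δ ^ 2 / n * socialCost D k := by positivity
    rcases le_or_gt (R * socialCost D k) (socialCost D j) with h | h
    · have := winProb_mul_socialCost_le hθ hf hn h
      linarith
    by_cases hgap : ∀ c, expectedBorda θ D c ≤ expectedBorda θ D j + δ * n
    · have hk0 : 0 < socialCost D k := by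
        have := (socialCost_nonneg D j).trans_lt h
        exact pos_of_mul_pos_right this hR0.le
      have := socialCost_le_of_almost_winner hθ D hδ hδn hk0 h.le hgap
      have := mul_le_mul_of_nonneg_left this hw0
      linarith
    · push Not at hgap
      obtain ⟨c, hc⟩ := hgap
      have hw := winProb_le_of_gap (f := f) (by linarith) hf (by linarith) hc.le
      have : winProb θ D f j * socialCost D j ≤ n * m ^ 2 / (δ * n) ^ 2 * (R * socialCost D k) :=
        mul_le_mul hw h.le (socialCost_nonneg D j) (by positivity)
      have e : n * m ^ 2 / (δ * n) ^ 2 * (R * socialCost D k) =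
          m ^ 2 * R / δ ^ 2 / n * socialCost D k := by field_simp
      linarith
  rw [expectedCost_eq_sum_winProb]
  refine (Finset.sum_le_sum fun j _ => hj j).trans_eq ?_
  rw [Finset.sum_add_distrib, ← Finset.sum_mul, sum_winProb]
  simp only [Finset.sum_const, Finset.card_univ, Fintype.card_fin, nsmul_eq_mul]
  ring

lemma iInf_ofReal_socialCost {n m : ℕ} (D : PseudoMetricSpace (Fin n ⊕ Fin m)) (hm : 1 ≤ m) :
    ∃ k, ⨅ j, ENNReal.ofReal (socialCost D j) = ENNReal.ofReal (socialCost D k) := by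
  have : Nonempty (Fin m) := ⟨⟨0, hm⟩⟩
  obtain ⟨k, hk⟩ := Finite.exists_min (socialCost D)
  exact ⟨k, le_antisymm (iInf_le _ k) (le_iInf fun j => ENNReal.ofReal_le_ofReal (hk j))⟩

lemma distortionPL_le {n m : ℕ} {θ : ℝ} (hθ : 1 < θ) (hm : 1 ≤ m) {f : VotingRule n m}
    (hf : IsBordaRule f) {δ : ℝ} (hδ : 0 < δ) (hδn : 1 ≤ δ * n) :
    distortionPL θ f ≤ ENNReal.ofReal (limitDistortion θ m * (1 + 2 * δ * (1 + (1 + 4 * m))) +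
      m * (16 * m ^ 2 + m ^ 2 * (1 + 4 * m) / δ ^ 2) / n) := by
  refine iSup_le fun D => ?_
  obtain ⟨k, hk⟩ := iInf_ofReal_socialCost D hm
  rw [hk]
  refine ENNReal.div_le_of_le_mul ?_
  rw [← ENNReal.ofReal_mul' (socialCost_nonneg D k)]
  exact ENNReal.ofReal_le_ofReal (expectedCost_le hθ D hf hδ hδn k)

/-! ### The lower bound by replication of voters -/

/-- The averages of a sequence that runs periodically through finitely many values converge to the
average of these values. -/
lemma tendsto_sum_mod_div {n₀ : ℕ} (hn₀ : 0 < n₀) (g : Fin n₀ → ℝ) :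
    Tendsto (fun n : ℕ => (∑ i : Fin n, g ⟨i % n₀, Nat.mod_lt _ hn₀⟩) / n) atTop
      (𝓝 ((∑ i, g i) / n₀)) := by
  have hn₀' : (0 : ℝ) < n₀ := by exact_mod_cast hn₀
  set G : ℕ → ℝ := fun i => g ⟨i % n₀, Nat.mod_lt _ hn₀⟩ with hG
  have hGper : ∀ x, G (n₀ + x) = G x := fun x => by simp [hG]
  have hsum : ∀ n : ℕ, ∑ i : Fin n, g ⟨i % n₀, Nat.mod_lt _ hn₀⟩ = ∑ i ∈ Finset.range n, G i :=
    fun n => Fin.sum_univ_eq_sum_range G n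
  have htot : ∑ i ∈ Finset.range n₀, G i = ∑ i, g i := by
    rw [← hsum]
    exact Finset.sum_congr rfl fun i _ => by congr; exact Nat.mod_eq_of_lt i.isLt
  set h : ℕ → ℝ := fun n => ∑ i ∈ Finset.range n, G i - n * ((∑ i, g i) / n₀) with hh
  have hper : Function.Periodic h n₀ := by
    intro n
    simp only [hh]
    rw [add_comm n n₀, Finset.sum_range_add, htot]
    simp only [hGper]
    push_cast
    field_simp
    ring
  obtain ⟨C, hC⟩ : ∃ C, ∀ n, |h n| ≤ C := by
    refine ⟨∑ i ∈ Finset.range n₀, |h i|, fun n => ?_⟩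
    rw [← hper.map_mod_nat n]
    exact Finset.single_le_sum (f := fun i => |h i|) (fun i _ => abs_nonneg _)
      (Finset.mem_range.2 (Nat.mod_lt _ hn₀))
  have hlim : Tendsto (fun n : ℕ => h n / n) atTop (𝓝 0) := by
    refine squeeze_zero_norm (a := fun n : ℕ => C / n) (fun n => ?_)
      (tendsto_const_div_atTop_nhds_zero_nat C)
    rw [norm_div, Real.norm_eq_abs, Real.norm_natCast]
    gcongr
    exact hC n
  have := hlim.add_const ((∑ i, g i) / n₀)
  rw [zero_add] at this
  refine this.congr' ?_
  filter_upwards [eventually_gt_atTop 0] with n hn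
  have hn' : (n : ℝ) ≠ 0 := by exact_mod_cast hn.ne'
  rw [hsum]
  simp only [hh]
  field_simp
  ring

/-- If candidate `j` is a strict winner in expectation, then with many copies of each voter a
candidate at the location of `j` is elected with probability close to `1`. -/
lemma exists_tendsto_le_distortionPL {n₀ m : ℕ} {θ : ℝ} (hθ : 0 < θ)
    {D : PseudoMetricSpace (Fin n₀ ⊕ Fin m)} {j k : Fin m} (hj : IsStrictWinner θ D j)
    (hk : 0 < socialCost D k) {f : (n : ℕ) → VotingRule n m} (hf : ∀ n, IsBordaRule (f n)) :
    ∃ b : ℕ → ℝ, Tendsto b atTop (𝓝 (socialCost D j / socialCost D k)) ∧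
      ∀ᶠ n in atTop, ENNReal.ofReal (b n) ≤ distortionPL θ (f n) := by
  have hn₀ : 0 < n₀ := by
    refine Nat.pos_of_ne_zero ?_
    rintro rfl
    simp [socialCost] at hk
  have hn₀' : (0 : ℝ) < n₀ := by exact_mod_cast hn₀
  let φ : (n : ℕ) → Fin n → Fin n₀ := fun n i => ⟨i % n₀, Nat.mod_lt _ hn₀⟩
  let D' : (n : ℕ) → PseudoMetricSpace (Fin n ⊕ Fin m) := fun n =>
    PseudoMetricSpace.induced (Sum.elim (fun i => Sum.inl (φ n i)) Sum.inr) D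
  have hcost : ∀ n i, cost (D' n) i = cost D (φ n i) := fun n i => rfl
  have hSC : ∀ c, Tendsto (fun n => socialCost (D' n) c / n) atTop
      (𝓝 (socialCost D c / n₀)) := fun c => tendsto_sum_mod_div hn₀ fun i => cost D i c
  have hEB : ∀ c, Tendsto (fun n => expectedBorda θ (D' n) c / n) atTop
      (𝓝 (expectedBorda θ D c / n₀)) := fun c =>
    tendsto_sum_mod_div hn₀ fun i => share θ (cost D i) (cost D i c)
  let gap : ℕ → Fin m → ℝ := fun n c => expectedBorda θ (D' n) j - expectedBorda θ (D' n) c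
  let bad : Finset (Fin m) := Finset.univ.filter fun c => D.dist (Sum.inr c) (Sum.inr j) ≠ 0
  have hgap : ∀ c, Tendsto (fun n => gap n c / n) atTop
      (𝓝 ((expectedBorda θ D j - expectedBorda θ D c) / n₀)) := by
    intro c
    simp only [gap, sub_div]
    exact (hEB j).sub (hEB c)
  have hgap0 : ∀ c ∈ bad, 0 < (expectedBorda θ D j - expectedBorda θ D c) / n₀ := by
    intro c hc
    refine div_pos (sub_pos.2 ((hj c).resolve_right ?_)) hn₀'
    simpa [bad] using hc
  have hbad : ∀ c ∈ bad, Tendsto (fun n : ℕ => n * (m : ℝ) ^ 2 / gap n c ^ 2) atTop (𝓝 0) := by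
    intro c hc
    have h1 : Tendsto (fun n : ℕ => (m : ℝ) ^ 2 / n / (gap n c / n) ^ 2) atTop
        (𝓝 (0 / ((expectedBorda θ D j - expectedBorda θ D c) / n₀) ^ 2)) :=
      (tendsto_const_div_atTop_nhds_zero_nat _).div ((hgap c).pow 2)
        (pow_ne_zero 2 (hgap0 c hc).ne')
    rw [zero_div] at h1
    refine h1.congr' ?_
    filter_upwards [eventually_gt_atTop 0] with n hn
    have hn' : (n : ℝ) ≠ 0 := by exact_mod_cast hn.ne'
    field_simp
  refine ⟨fun n => (socialCost (D' n) j / n) / (socialCost (D' n) k / n) *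
    (1 - ∑ c ∈ bad, n * (m : ℝ) ^ 2 / gap n c ^ 2), ?_, ?_⟩
  · have h1 := ((hSC j).div (hSC k) (div_pos hk hn₀').ne').mul
      ((tendsto_const_nhds (x := (1 : ℝ))).sub (tendsto_finsetSum bad hbad))
    simpa [div_div_div_cancel_right₀ hn₀'.ne'] using h1
  · have hev1 : ∀ᶠ n in atTop, ∀ c ∈ bad, 0 < gap n c / n :=
      (Finset.eventually_all bad).2 fun c hc => (hgap c).eventually_const_lt (hgap0 c hc)
    have hev2 : ∀ᶠ n in atTop, 0 < socialCost (D' n) k / n :=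
      (hSC k).eventually_const_lt (div_pos hk hn₀')
    filter_upwards [hev1, hev2, eventually_gt_atTop 0] with n h1 h2 hn
    have hn' : (0 : ℝ) < n := by exact_mod_cast hn
    have hk' : 0 < socialCost (D' n) k := by
      rw [div_pos_iff_of_pos_right hn'] at h2; exact h2
    rw [div_div_div_cancel_right₀ hn'.ne']
    have hcostle : socialCost (D' n) j * (1 - ∑ c ∈ bad, n * (m : ℝ) ^ 2 / gap n c ^ 2) ≤
        expectedCost θ (D' n) (f n) := by
      have hw : 1 - ∑ c ∈ bad, n * (m : ℝ) ^ 2 / gap n c ^ 2 ≤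
          ∑ c ∈ badᶜ, winProb θ (D' n) (f n) c := by
        have hs := Finset.sum_add_sum_compl bad fun c => winProb θ (D' n) (f n) c
        rw [sum_winProb] at hs
        have : ∑ c ∈ bad, winProb θ (D' n) (f n) c ≤
            ∑ c ∈ bad, n * (m : ℝ) ^ 2 / gap n c ^ 2 := by
          refine Finset.sum_le_sum fun c hc => ?_
          have hg : 0 < gap n c := by
            have := h1 c hc
            rwa [div_pos_iff_of_pos_right hn'] at this
          exact winProb_le_of_gap (c := j) hθ (hf n) hg (by simp only [gap]; linarith)
        linarith
      calc _ ≤ socialCost (D' n) j * ∑ c ∈ badᶜ, winProb θ (D' n) (f n) c :=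
            mul_le_mul_of_nonneg_left hw (socialCost_nonneg _ _)
        _ = ∑ c ∈ badᶜ, winProb θ (D' n) (f n) c * socialCost (D' n) c := by
            rw [Finset.mul_sum]
            refine Finset.sum_congr rfl fun c hc => ?_
            have hc' : D.dist (Sum.inr c) (Sum.inr j) = 0 := by simpa [bad] using hc
            have : (D' n).dist (Sum.inr c) (Sum.inr j) = 0 := hc'
            rw [socialCost_eq_of_dist_eq_zero (D' n) this, mul_comm]
        _ ≤ ∑ c, winProb θ (D' n) (f n) c * socialCost (D' n) c :=
            Finset.sum_le_sum_of_subset_of_nonneg (Finset.subset_univ _) fun c _ _ =>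
              mul_nonneg (winProb_nonneg c) (socialCost_nonneg _ _)
        _ = _ := expectedCost_eq_sum_winProb.symm
    calc _ ≤ ENNReal.ofReal (expectedCost θ (D' n) (f n) / socialCost (D' n) k) := by
          refine ENNReal.ofReal_le_ofReal ?_
          rw [div_mul_eq_mul_div]
          gcongr
      _ = ENNReal.ofReal (expectedCost θ (D' n) (f n)) /
            ENNReal.ofReal (socialCost (D' n) k) := ENNReal.ofReal_div_of_pos hk'
      _ ≤ ENNReal.ofReal (expectedCost θ (D' n) (f n)) /
            ⨅ c, ENNReal.ofReal (socialCost (D' n) c) := ENNReal.div_le_div_left (iInf_le _ k) _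
      _ ≤ distortionPL θ (f n) := le_iSup (fun D : PseudoMetricSpace (Fin n ⊕ Fin m) =>
            ENNReal.ofReal (expectedCost θ D (f n)) / ⨅ c, ENNReal.ofReal (socialCost D c)) (D' n)

theorem tendsto_distortionPL {m : ℕ} {θ : ℝ} (hθ : 1 < θ) (hm : 1 ≤ m)
    {f : (n : ℕ) → VotingRule n m} (hf : ∀ n, IsBordaRule (f n)) :
    Tendsto (fun n => distortionPL θ (f n)) atTop (𝓝 (ENNReal.ofReal (limitDistortion θ m))) := by
  refine tendsto_order.2 ⟨fun a ha => ?_, fun a ha => ?_⟩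
  · have ha' : a.toReal < limitDistortion θ m := (ENNReal.lt_ofReal_iff_toReal_lt ha.ne_top).1 ha
    obtain ⟨ρ, ⟨n₀, D, j, k, hj, hk, rfl⟩, hρ⟩ :=
      exists_lt_of_lt_csSup ⟨1, one_mem_winnerRatios θ hm⟩ ha'
    obtain ⟨b, hb, hle⟩ := exists_tendsto_le_distortionPL (by linarith) hj hk hf
    filter_upwards [hle, hb.eventually_const_lt hρ] with n h1 h2
    exact ((ENNReal.lt_ofReal_iff_toReal_lt ha.ne_top).2 h2).trans_le h1
  · have h1 : Tendsto (fun δ : ℝ => ENNReal.ofReal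
        (limitDistortion θ m * (1 + 2 * δ * (1 + (1 + 4 * m))))) (𝓝[>] 0)
        (𝓝 (ENNReal.ofReal (limitDistortion θ m))) := by
      refine ENNReal.tendsto_ofReal ?_
      have : Continuous fun δ : ℝ => limitDistortion θ m * (1 + 2 * δ * (1 + (1 + 4 * m))) := by
        fun_prop
      simpa using (this.tendsto 0).mono_left nhdsWithin_le_nhds
    obtain ⟨δ, hδa, hδ⟩ := ((h1.eventually_lt_const ha).and self_mem_nhdsWithin).exists
    have hδ0 : 0 < δ := hδ
    have h2 : Tendsto (fun n : ℕ => ENNReal.ofReal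
        (limitDistortion θ m * (1 + 2 * δ * (1 + (1 + 4 * m))) +
        m * (16 * m ^ 2 + m ^ 2 * (1 + 4 * m) / δ ^ 2) / n)) atTop
        (𝓝 (ENNReal.ofReal (limitDistortion θ m * (1 + 2 * δ * (1 + (1 + 4 * m)))))) := by
      refine ENNReal.tendsto_ofReal ?_
      simpa using (tendsto_const_div_atTop_nhds_zero_nat
        (m * (16 * m ^ 2 + m ^ 2 * (1 + 4 * m) / δ ^ 2) : ℝ)).const_add
        (limitDistortion θ m * (1 + 2 * δ * (1 + (1 + 4 * m))))
    have h3 : ∀ᶠ n : ℕ in atTop, 1 ≤ δ * n :=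
      (tendsto_natCast_atTop_atTop.const_mul_atTop hδ0).eventually_ge_atTop 1
    filter_upwards [h2.eventually_lt_const hδa, h3] with n hn1 hn2
    exact (distortionPL_le hθ hm (hf n) hδ0 hn2).trans_lt hn1

/-! ### An election with large distortion -/

lemma share_eq_of_forall_ne {m : ℕ} {θ : ℝ} {d : Fin m → ℝ} {j k : Fin m} (hjk : j ≠ k) {Z : ℝ}
    (hd : ∀ c, c ≠ k → c ≠ j → d c = Z) (x : ℝ) :
    share θ d x = pairProb θ x (d k) + pairProb θ x (d j) + (m - 2) * pairProb θ x Z := by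
  have hm : 2 ≤ m := by
    have : ({j, k} : Finset (Fin m)).card ≤ Fintype.card (Fin m) := Finset.card_le_univ _
    rwa [Finset.card_pair hjk, Fintype.card_fin] at this
  have hcard : (((Finset.univ.erase k).erase j).card : ℝ) = m - 2 := by
    rw [Finset.card_erase_of_mem (by simp [hjk]), Finset.card_erase_of_mem (Finset.mem_univ k),
      Finset.card_univ, Fintype.card_fin, Nat.sub_sub, Nat.cast_sub hm]
    norm_num
  unfold share
  rw [← Finset.add_sum_erase _ _ (Finset.mem_univ k),
    ← Finset.add_sum_erase _ _ (show j ∈ Finset.univ.erase k by simp [hjk]), ← hcard, add_assoc]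
  congr 2
  rw [← nsmul_eq_mul, ← Finset.sum_const]
  refine Finset.sum_congr rfl fun c hc => ?_
  simp only [Finset.mem_erase] at hc
  rw [hd c hc.2.1 hc.1]

/-- On a line, candidate `k` is at `0`, candidate `j` at `1`, and all others are at
`Z = m ^ (1 / θ)`. There are `m - 2` voters at `0`, each of which gives at most two more points
to `k` than to `j`, because the others are so far away. About `4 * Z` voters half way between `0`
and `Z` suffice to make up for this, since each of them gives of the order of `m / Z`
more points to `j`. -/
lemma exists_winnerRatio_ge {θ : ℝ} (hθ : 1 < θ) {m : ℕ} (hm : 3 ≤ m) {Z : ℝ} (hZ : 4 ≤ Z)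
    (hZm : Z ^ θ = m) : ∃ ρ ∈ winnerRatios θ m, 2 / 15 * (m / Z ^ 2) ≤ ρ := by
  have hθ0 : 0 < θ := by linarith
  have hm3 : (3 : ℝ) ≤ m := by exact_mod_cast hm
  let k : Fin m := ⟨0, by omega⟩
  let j : Fin m := ⟨1, by omega⟩
  have hjk : j ≠ k := by simp [j, k]
  let e : ℕ := ⌊4 * Z⌋₊ + 1
  have he1 : 4 * Z < e := by
    have := Nat.lt_floor_add_one (4 * Z)
    simpa [e] using this
  have he2 : (e : ℝ) ≤ 5 * Z := by
    have := Nat.floor_le (show 0 ≤ 4 * Z by linarith)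
    have h' : (e : ℝ) = ⌊4 * Z⌋₊ + 1 := by simp [e]
    linarith
  let pos : Fin m → ℝ := fun c => if c = k then 0 else if c = j then 1 else Z
  have hposk : pos k = 0 := if_pos rfl
  have hposj : pos j = 1 := by simp [pos, hjk]
  have hpos : ∀ c, c ≠ k → c ≠ j → pos c = Z := fun c h1 h2 => by simp [pos, h1, h2]
  let voter : Fin ((m - 2) + e) → ℝ := Fin.append (fun _ => 0) fun _ => Z / 2
  let D : PseudoMetricSpace (Fin ((m - 2) + e) ⊕ Fin m) :=
    PseudoMetricSpace.induced (Sum.elim voter pos) inferInstance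
  have hcost1 : ∀ i : Fin (m - 2), cost D (Fin.castAdd e i) = fun c => |0 - pos c| := fun i => by
    funext c
    change |voter _ - pos c| = _
    simp only [voter, Fin.append_left]
  have hcost2 : ∀ i : Fin e, cost D (Fin.natAdd (m - 2) i) = fun c => |Z / 2 - pos c| :=
    fun i => by
      funext c
      change |voter _ - pos c| = _
      simp only [voter, Fin.append_right]
  set d₁ : Fin m → ℝ := fun c => |0 - pos c| with hd₁
  set d₂ : Fin m → ℝ := fun c => |Z / 2 - pos c| with hd₂
  have h1k : d₁ k = 0 := by simp [hd₁, hposk]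
  have h1j : d₁ j = 1 := by simp [hd₁, hposj]
  have h1 : ∀ c, c ≠ k → c ≠ j → d₁ c = Z := fun c hc hc' => by
    simp only [hd₁, hpos c hc hc', zero_sub, abs_neg]
    exact abs_of_nonneg (by linarith)
  have h2k : d₂ k = Z / 2 := by
    simp only [hd₂, hposk, sub_zero]
    exact abs_of_nonneg (by linarith)
  have h2j : d₂ j = Z / 2 - 1 := by
    simp only [hd₂, hposj]
    exact abs_of_nonneg (by linarith)
  have h2 : ∀ c, c ≠ k → c ≠ j → d₂ c = Z / 2 := fun c hc hc' => by
    simp only [hd₂, hpos c hc hc']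
    rw [abs_sub_comm, abs_of_nonneg (by linarith)]; ring
  have hm2 : ((m - 2 : ℕ) : ℝ) = m - 2 := by rw [Nat.cast_sub (by omega)]; norm_num
  have hSC : ∀ c, socialCost D c = (m - 2) * d₁ c + e * d₂ c := by
    intro c
    unfold socialCost
    rw [Fin.sum_univ_add]
    simp only [hcost1, hcost2]
    simp [hm2]
  have hEB : ∀ c, expectedBorda θ D c = (m - 2) * share θ d₁ (d₁ c) + e * share θ d₂ (d₂ c) := by
    intro c
    unfold expectedBorda
    rw [Fin.sum_univ_add]
    simp only [hcost1, hcost2]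
    simp [hm2]
  have hs1 : ∀ x, share θ d₁ x = pairProb θ x 0 + pairProb θ x 1 + (m - 2) * pairProb θ x Z :=
    fun x => by rw [share_eq_of_forall_ne hjk h1, h1k, h1j]
  have hs2 : ∀ x, share θ d₂ x =
      pairProb θ x (Z / 2) + pairProb θ x (Z / 2 - 1) + (m - 2) * pairProb θ x (Z / 2) :=
    fun x => by rw [share_eq_of_forall_ne hjk h2, h2k, h2j]
  have hp1Z : pairProb θ 1 Z = m / (1 + m) := by
    rw [pairProb_of_left_ne one_ne_zero, Real.one_rpow, hZm]
  have hpZ1 : pairProb θ Z 1 = 1 / (m + 1) := by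
    rw [pairProb_of_right_ne _ one_ne_zero, Real.one_rpow, hZm]
  have hs1k : share θ d₁ 0 = 1 / 2 + 1 + (m - 2) := by
    rw [hs1, pairProb_self le_rfl, pairProb_zero_left hθ0 one_pos,
      pairProb_zero_left hθ0 (by linarith), mul_one]
  have hs1j : share θ d₁ 1 = 1 / 2 + (m - 2) * (m / (1 + m)) := by
    rw [hs1, pairProb_zero_right hθ0 one_pos, pairProb_self zero_le_one, hp1Z, zero_add]
  have hs1c : share θ d₁ Z = 1 / (m + 1) + (m - 2) / 2 := by
    rw [hs1, pairProb_zero_right hθ0 (by linarith), hpZ1, pairProb_self (by linarith)]; ring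
  have hy : pairProb θ (Z / 2) (Z / 2 - 1) ≤ 1 / 2 - 1 / (2 * Z) := by
    refine (pairProb_le_div hθ.le (by linarith) (by linarith) (by linarith)).trans ?_
    rw [div_le_iff₀ (by linarith)]
    have : (1 / 2 - 1 / (2 * Z)) * (Z / 2 + (Z / 2 - 1)) = Z / 2 - 1 + 1 / (2 * Z) := by
      field_simp; ring
    rw [this]
    have : 0 < 1 / (2 * Z) := by positivity
    linarith
  have hy' := pairProb_add_swap (θ := θ) (show 0 ≤ Z / 2 by linarith)
    (show 0 ≤ Z / 2 - 1 by linarith)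
  have hZ2 : 0 < 1 / (2 * Z) := by positivity
  have hwin : IsStrictWinner θ D j := by
    intro c
    by_cases hcj : c = j
    · right; rw [hcj]; exact D.dist_self _
    left
    rw [hEB, hEB, h1j, h2j]
    by_cases hck : c = k
    · rw [hck, h1k, h2k, hs1k, hs1j]
      have hg : share θ d₂ (Z / 2) + (m - 2) * (1 / (2 * Z)) ≤ share θ d₂ (Z / 2 - 1) := by
        rw [hs2, hs2, pairProb_self (by linarith), pairProb_self (by linarith)]
        have : (m - 2) * (1 / 2 + 1 / (2 * Z)) ≤ (m - 2) * pairProb θ (Z / 2 - 1) (Z / 2) :=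
          mul_le_mul_of_nonneg_left (by linarith) (by linarith)
        linarith
      have hb : 1 / 2 + 1 + ((m : ℝ) - 2) ≤ 1 / 2 + (m - 2) * (m / (1 + m)) + 2 := by
        have : (m : ℝ) / (1 + m) = 1 - 1 / (1 + m) := by field_simp; ring
        have h' : ((m : ℝ) - 2) * (1 / (1 + m)) ≤ 1 := by
          rw [mul_one_div, div_le_one (by linarith)]; linarith
        rw [this]; linarith
      have he : 2 * ((m : ℝ) - 2) < e * ((m - 2) * (1 / (2 * Z))) := by
        have : (e : ℝ) * ((m - 2) * (1 / (2 * Z))) = (m - 2) * (e / (2 * Z)) := by ring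
        rw [this, mul_comm]
        refine mul_lt_mul_of_pos_left ?_ (by linarith)
        rw [lt_div_iff₀ (by linarith)]; linarith
      have f1 := mul_le_mul_of_nonneg_left hb (show 0 ≤ (m : ℝ) - 2 by linarith)
      have f2 := mul_le_mul_of_nonneg_left hg (Nat.cast_nonneg (α := ℝ) e)
      linarith
    · rw [h1 c hck hcj, h2 c hck hcj, hs1c, hs1j]
      have hb : 1 / ((m : ℝ) + 1) + (m - 2) / 2 < 1 / 2 + (m - 2) * (m / (1 + m)) := by
        have f1 : 1 / ((m : ℝ) + 1) < 1 / 2 := by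
          apply one_div_lt_one_div_of_lt <;> linarith
        have f2 : 1 / 2 ≤ (m : ℝ) / (1 + m) := by
          rw [div_le_div_iff₀ (by norm_num) (by linarith)]; linarith
        have := mul_le_mul_of_nonneg_left f2 (show 0 ≤ (m : ℝ) - 2 by linarith)
        linarith
      have hg : share θ d₂ (Z / 2) ≤ share θ d₂ (Z / 2 - 1) :=
        share_anti hθ0 (fun c => abs_nonneg _) (by linarith) (by linarith)
      have f1 := mul_lt_mul_of_pos_left hb (show 0 < (m : ℝ) - 2 by linarith)
      have f2 := mul_le_mul_of_nonneg_left hg (Nat.cast_nonneg (α := ℝ) e)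
      linarith
  have hSCk : socialCost D k = e * (Z / 2) := by rw [hSC, h1k, h2k]; ring
  have hSCj : (m : ℝ) - 2 ≤ socialCost D j := by
    rw [hSC, h1j, h2j]
    have : 0 ≤ (e : ℝ) * (Z / 2 - 1) := mul_nonneg (Nat.cast_nonneg _) (by linarith)
    linarith
  have hk : 0 < socialCost D k := by
    rw [hSCk]; exact mul_pos (by linarith) (by linarith)
  refine ⟨_, ⟨_, D, j, k, hwin, hk, rfl⟩, ?_⟩
  rw [le_div_iff₀ hk, hSCk]
  have hE : (e : ℝ) * (Z / 2) ≤ 5 * Z * (Z / 2) :=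
    mul_le_mul_of_nonneg_right he2 (by linarith)
  calc 2 / 15 * (m / Z ^ 2) * (e * (Z / 2)) ≤ 2 / 15 * (m / Z ^ 2) * (5 * Z * (Z / 2)) :=
        mul_le_mul_of_nonneg_left hE (by positivity)
    _ = m / 3 := by field_simp; norm_num
    _ ≤ m - 2 := by linarith
    _ ≤ socialCost D j := hSCj

lemma eventually_le_limitDistortion {θ : ℝ} (hθ : 1 < θ) :
    ∀ᶠ m : ℕ in atTop, 2 / 15 * (m : ℝ) ^ max (1 - 2 / θ) 0 ≤ limitDistortion θ m := by
  have hθ0 : 0 < θ := by linarith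
  have hev : ∀ᶠ m : ℕ in atTop, (4 : ℝ) ^ θ ≤ m :=
    tendsto_natCast_atTop_atTop.eventually_ge_atTop _
  filter_upwards [hev, eventually_ge_atTop 3] with m hm4 hm
  have hm0 : (0 : ℝ) < m := by exact_mod_cast (by omega : 0 < m)
  rcases le_total (1 - 2 / θ) 0 with h | h
  · rw [max_eq_right h, Real.rpow_zero]
    have := le_csSup (bddAbove_winnerRatios hθ m) (one_mem_winnerRatios θ (by omega : 1 ≤ m))
    unfold limitDistortion
    linarith
  · rw [max_eq_left h]
    have hZ : 4 ≤ (m : ℝ) ^ (1 / θ) := by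
      rw [one_div, Real.le_rpow_inv_iff_of_pos (by norm_num) hm0.le hθ0]; exact hm4
    have hZm : ((m : ℝ) ^ (1 / θ)) ^ θ = m := by
      rw [← Real.rpow_mul hm0.le, one_div, inv_mul_cancel₀ hθ0.ne', Real.rpow_one]
    obtain ⟨ρ, hρ, hle⟩ := exists_winnerRatio_ge hθ hm hZ hZm
    have he : (m : ℝ) ^ (1 - 2 / θ) = m / ((m : ℝ) ^ (1 / θ)) ^ 2 := by
      rw [Real.rpow_sub hm0, Real.rpow_one, ← Real.rpow_mul_natCast hm0.le]
      congr 2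
      push_cast; ring
    rw [he]
    exact hle.trans (le_csSup (bddAbove_winnerRatios hθ m) hρ)

end MetricVoting

theorem mainTheorem1 (θ : ℝ) (hθ : 1 < θ) :
    ∃ L : ℕ → ℝ≥0,
      (∀ m : ℕ, 1 ≤ m → ∀ f : (n : ℕ) → MetricVoting.VotingRule n m,
        (∀ n, MetricVoting.IsBordaRule (f n)) →
          Tendsto (fun n => MetricVoting.distortionPL θ (f n)) atTop (𝓝 (L m : ℝ≥0∞))) ∧
      (fun m => (L m : ℝ)) =Θ[atTop] fun m : ℕ => (m : ℝ) ^ max (1 - 2 / θ) 0 := by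
  refine ⟨fun m => (MetricVoting.limitDistortion θ m).toNNReal,
    fun m hm f hf => MetricVoting.tendsto_distortionPL hθ hm hf, ?_, ?_⟩
  · obtain ⟨K, -, hK⟩ := MetricVoting.winnerRatios_bounded hθ
    refine IsBigO.of_bound K ?_
    filter_upwards [eventually_ge_atTop 1] with m hm
    rw [Real.coe_toNNReal _ (MetricVoting.limitDistortion_nonneg θ m),
      Real.norm_of_nonneg (MetricVoting.limitDistortion_nonneg θ m),
      Real.norm_of_nonneg (by positivity)]
    exact csSup_le ⟨1, MetricVoting.one_mem_winnerRatios θ hm⟩ (hK m)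
  · refine IsBigO.of_bound (15 / 2) ?_
    filter_upwards [MetricVoting.eventually_le_limitDistortion hθ] with m hm
    rw [Real.coe_toNNReal _ (MetricVoting.limitDistortion_nonneg θ m),
      Real.norm_of_nonneg (MetricVoting.limitDistortion_nonneg θ m),
      Real.norm_of_nonneg (by positivity)]
    linarith
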